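/- **Setting.** Let $\{1,\dots,n\}$ be partitioned into blocks $s_1,\dots,s_m$, let $\lambda>0$, $0<p<1$, $0<\ell\le L$, and let $f:\mathbb R^n\to\mathbb R$ be $C^1$ such that for each block $s_i$ there is $L_{s_i}\in[\ell,L]$ with $\|\nabla_{s_i}f(y)-\nabla_{s_i}f(z)\|\le L_{s_i}\|y-z\|$ whenever $y,z$ differ only in the block $s_i$. Put $F(x,\varepsilon)=f(x)+\lambda\sum_{i=1}^n(|x_i|+\varepsilon_i^2)^p$ for $x,\varepsilon\in\mathbb R^n$ and assume that $x\mapsto F(x,0)$ is coercive. **Algorithm (BPIREe-$\ell_p$).** Let $\mu\in(0,1)$, $\delta<1$, $x^{-1}=x^0\in\mathbb R^n$ and $\varepsilon^0\in(0,\infty)^n$. In iteration $k=1,2,\dots$ a block $b_k=s_i$ is chosen. Set $\hat x^k_{s_i}=x^{k-1}_{s_i}+\beta_k(x^{k-1}_{s_i}-x^{\rm prev}_{s_i})$, where $x^{\rm prev}_{s_i}$ is the value of the block before its last update ($x^{\rm prev}=x^0$ if it has not been updated yet), $0\le\beta_k\le1$. Then $x^k$ equals $x^{k-1}$ off $s_i$,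 and $x^k_{s_i}$ minimizes over $x_{s_i}$ $$\langle\nabla_{s_i}f(x^{k-1}_{\ne s_i},\hat x^k_{s_i}),x_{s_i}\rangle+\tfrac1{2\alpha_k}\|x_{s_i}-\hat x^k_{s_i}\|^2+\sum_{j\in s_i}w_j^{k-1}|x_j|,\qquad w_j^{k-1}=\lambda p\,(|x_j^{k-1}|+(\varepsilon_j^{k-1})^2)^{p-1}.$$ Here $\alpha_k=1/(2L_k)$, where $L_k\in[\ell,L]$ is a Lipschitz constant of $\nabla_{s_i}f(x^{k-1}_{\ne s_i},\cdot)$, and, if $s_i$ was updated before, $\beta_k\le\frac\delta6\sqrt{L_\kappa/L_k}$, where $\kappa<k$ is the last iteration that updated $s_i$. For every $j$, $\varepsilon^k_j=\varepsilon^{k-1}_j$ if $x^k_j=0$, and $0<\varepsilon^k_j\le\sqrt\mu\,\varepsilon^{k-1}_j$ if $x^k_j\neq0$. Assume that for some $T\in\mathbb N$ every block is updated at least once in any $T$ consecutive iterations, and that $F(x^k,\varepsilon^k)\le F(x^{k-1},\varepsilon^{k-1})$ for all $k\ge1$. Let $\mathcal I^*$ be the set of indices $i$ with $x^k_i\ne0$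 for all large $k$. For $N\in\mathbb N$ let $d^N_{s_i}$ be the number of updates of the block $s_i$ in the iterations $1,\dots,N$, and let $\|\varepsilon^{d^N}\|_1$ be the sum over $j\in\mathcal I^*$ of the values of $\varepsilon_j$ at the iteration of the $d^N_{s_i}$-th update of the block $s_i\ni j$ (of $\varepsilon^0_j$ if $d^N_{s_i}=0$). **KL property.** A function $J$ on a Euclidean space has the KL property at $\bar z$ with $\phi(s)=cs^{1-\theta}$ if $\partial J(\bar z)\neq\emptyset$ and there are a neighbourhood $U$ of $\bar z$ and $\xi>0$ with $\phi'(J(z)-J(\bar z))\,\mathrm{dist}(0,\partial J(z))\ge1$ for all $z\in U$ with $J(\bar z)<J(z)<J(\bar z)+\xi$, where $\partial$ is the limiting subdifferential. **Theorem.** Let $x^*$ be a limit point of $(x^k)$ such that for some $\rho>0$ each $\nabla_{s_i}f$ is Lipschitz continuous on the ball $B_{4\rho}(x^*)$. Assume that, for some $c>0$ and $\theta\in[0,1)$, the reduced function $(x_{\mathcal I^*},\varepsilon_{\mathcal I^*})\mapsto f(x_{\mathcal I^*},0)+\lambda\sum_{i\in\mathcal I^*}(|x_i|+\varepsilon_i^2)^p$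 on $\mathbb R^{2|\mathcal I^*|}$ has the KL property at $(x^*_{\mathcal I^*},0)$ with $\phi(s)=cs^{1-\theta}$. Then: 1. if $\theta=0$, there is $k_0$ with $x^k=x^*$ for all $k\ge k_0$; 2. if $\theta\in(0,\frac12]$, there are $c_{10},c_{11}>0$ and $\alpha\in[0,1)$ with $\|x^k-x^*\|\le c_{10}\alpha^k-c_{11}\|\varepsilon^{d^{3(k-1)T}}\|_1$ for all $k\ge0$ (for $k=0$ with $\varepsilon^0$, i.e. index $0$, in the last term); 3. if $\theta\in(\frac12,1)$, there are $c_{12},c_{13}>0$ with $\|x^k-x^*\|\le c_{12}k^{-\frac{1-\theta}{2\theta-1}}-c_{13}\|\varepsilon^{d^{3(k-1)T}}\|_1$ for all $k\ge1$. -/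

import Mathlib

open Filter Topology

namespace BPIRe

section KL

variable {E : Type*} [NormedAddCommGroup E] [InnerProductSpace ℝ E]

/-- Fréchet subdifferential of a finite function `J` at `x`:
`liminf_{y → x, y ≠ x} (J y - J x - ⟪u, y - x⟫) / ‖y - x‖ ≥ 0`, written without quotients. -/
def frechetSubdifferential (J : E → ℝ) (x : E) : Set E :=
  {u | ∀ η : ℝ, 0 < η → ∀ᶠ y in 𝓝 x, -(η * ‖y - x‖) ≤ J y - J x - inner ℝ u (y - x)}

/-- Limiting subdifferential of a finite function `J` at `x`. -/
def limitingSubdifferential (J : E → ℝ) (x : E) : Set E :=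
  {u | ∃ (y v : ℕ → E), Tendsto y atTop (𝓝 x) ∧ Tendsto (fun k => J (y k)) atTop (𝓝 (J x)) ∧
    (∀ k, v k ∈ frechetSubdifferential J (y k)) ∧ Tendsto v atTop (𝓝 u)}

/-- `J` has the Kurdyka–Łojasiewicz property at `xbar` with desingularizing function `φ`.
The distance of `0` to the subdifferential takes values in `[0, ∞]` and is `∞` if the latter is
empty. (The bound `ξ` may be taken finite, as the property passes to smaller `ξ`.) -/
def HasKLProperty (J : E → ℝ) (xbar : E) (φ : ℝ → ℝ) : Prop :=
  (limitingSubdifferential J xbar).Nonempty ∧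
  ∃ U ∈ 𝓝 xbar, ∃ ξ : ℝ, 0 < ξ ∧
    φ 0 = 0 ∧ (∀ s ∈ Set.Ico 0 ξ, 0 ≤ φ s) ∧ ContDiffOn ℝ 1 φ (Set.Ioo 0 ξ) ∧
    (∀ s ∈ Set.Ioo 0 ξ, 0 < deriv φ s) ∧
    ∀ x ∈ U, J xbar < J x → J x < J xbar + ξ →
      1 ≤ ENNReal.ofReal (deriv φ (J x - J xbar)) *
        Metric.infEDist 0 (limitingSubdifferential J x)

end KL

section Problem

variable {n m : ℕ}

/-- The part of `v` in the block `s_i = {j | blk j = i}`; the other coordinates are set to `0`. -/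
noncomputable def blockPart (blk : Fin n → Fin m) (i : Fin m) (v : EuclideanSpace ℝ (Fin n)) :
    EuclideanSpace ℝ (Fin n) :=
  WithLp.toLp 2 fun j => if blk j = i then v j else 0

/-- `y` and `z` have the same coordinates outside the block `s_i`. -/
def AgreeOff (blk : Fin n → Fin m) (i : Fin m) (y z : EuclideanSpace ℝ (Fin n)) : Prop :=
  ∀ j, blk j ≠ i → y j = z j

/-- The smoothed objective `F(x, ε) = f(x) + λ ∑ᵢ (|xᵢ| + εᵢ²)^p`. -/
noncomputable def objective (f : EuclideanSpace ℝ (Fin n) → ℝ) (lam p : ℝ)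
    (x : EuclideanSpace ℝ (Fin n)) (ε : Fin n → ℝ) : ℝ :=
  f x + lam * ∑ i, (|x i| + ε i ^ 2) ^ p

/-- Standing assumptions on the problem: `f` is `C¹`, its block gradients are Lipschitz in the
block variable with constants in `[ℓ, L]`, and the `ℓ_p`-regularized objective is coercive. -/
structure ProblemAssumption (blk : Fin n → Fin m) (f : EuclideanSpace ℝ (Fin n) → ℝ)
    (lam p ℓ L : ℝ) : Prop where
  lam_pos : 0 < lam
  p_pos : 0 < p
  p_lt_one : p < 1
  ell_pos : 0 < ℓ
  contDiff : ContDiff ℝ 1 f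
  blockLipschitz : ∀ i : Fin m, ∃ Li : ℝ, ℓ ≤ Li ∧ Li ≤ L ∧ ∀ y z, AgreeOff blk i y z →
    ‖blockPart blk i (gradient f y - gradient f z)‖ ≤ Li * ‖y - z‖
  coercive : Tendsto (fun x => objective f lam p x 0)
    (Bornology.cobounded (EuclideanSpace ℝ (Fin n))) atTop

/-- The last iteration `κ ∈ {1, …, k}` in which block `i` was updated; `0` if there is none. -/
def lastUpdate (b : ℕ → Fin m) (i : Fin m) (k : ℕ) : ℕ :=
  Nat.findGreatest (fun κ => 1 ≤ κ ∧ b κ = i) k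

/-- The point `(x^{k-1}_{≠ s_i}, x̂^k_{s_i})`, `s_i = b_k`, where
`x̂^k_{s_i} = x^{k-1}_{s_i} + β_k (x^{k-1}_{s_i} - x^prev_{s_i})`. If `κ < k` is the last iteration
that updated the block, then `x^prev_{s_i} = x^{κ-1}_{s_i}` is the value before that update; if
there is none (`κ = 0`), then `x^prev = x^{-1} = x^0`, which is `x (0 - 1)` in `ℕ`. -/
noncomputable def extrapolated (blk : Fin n → Fin m) (b : ℕ → Fin m) (β : ℕ → ℝ)
    (x : ℕ → EuclideanSpace ℝ (Fin n)) (k : ℕ) : EuclideanSpace ℝ (Fin n) :=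
  x (k - 1) + β k • blockPart blk (b k) (x (k - 1) - x (lastUpdate b (b k) (k - 1) - 1))

/-- The weight `w_j = λ p (|x_j| + ε_j²)^{p-1}`. -/
noncomputable def weight (lam p : ℝ) (x : EuclideanSpace ℝ (Fin n)) (ε : Fin n → ℝ)
    (j : Fin n) : ℝ :=
  lam * p * (|x j| + ε j ^ 2) ^ (p - 1)

/-- The objective of the subproblem of the block `s_i`, with linearization and proximal point `y`,
stepsize `a` and weights `w`; only the coordinates of `z` in `s_i` enter. -/
noncomputable def subproblem (blk : Fin n → Fin m) (f : EuclideanSpace ℝ (Fin n) → ℝ) (i : Fin m)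
    (y : EuclideanSpace ℝ (Fin n)) (a : ℝ) (w : Fin n → ℝ) (z : EuclideanSpace ℝ (Fin n)) : ℝ :=
  inner ℝ (blockPart blk i (gradient f y)) (blockPart blk i z)
    + 1 / (2 * a) * ‖blockPart blk i (z - y)‖ ^ 2
    + ∑ j with blk j = i, w j * |z j|

/-- `(x^k, ε^k)` is generated by the algorithm, with chosen blocks `b_k`, Lipschitz constants
`L_k`, stepsizes `1 / (2 L_k)` and extrapolation parameters `β_k` (`k ≥ 1`). -/
structure IsGenerated (blk : Fin n → Fin m) (f : EuclideanSpace ℝ (Fin n) → ℝ)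
    (lam p ℓ L δ μ : ℝ) (b : ℕ → Fin m) (Lk β : ℕ → ℝ)
    (x : ℕ → EuclideanSpace ℝ (Fin n)) (ε : ℕ → Fin n → ℝ) : Prop where
  eps_init : ∀ j, 0 < ε 0 j
  /-- `L_k ∈ [ℓ, L]` is a Lipschitz constant of `∇_{b_k} f(x^{k-1}_{≠ b_k}, ·)`. -/
  lip_mem : ∀ k, 1 ≤ k → ℓ ≤ Lk k ∧ Lk k ≤ L
  lip_spec : ∀ k, 1 ≤ k → ∀ y z, AgreeOff blk (b k) y (x (k - 1)) →
    AgreeOff blk (b k) z (x (k - 1)) →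
    ‖blockPart blk (b k) (gradient f y - gradient f z)‖ ≤ Lk k * ‖y - z‖
  beta_mem : ∀ k, 1 ≤ k → 0 ≤ β k ∧ β k ≤ 1
  /-- The bound by `δ / 6 * √(L̃^{j-1} / L̃^j)`; at the first update of a block there is no previous
  Lipschitz constant and the extrapolation term vanishes. -/
  beta_le : ∀ k, 1 ≤ k → 1 ≤ lastUpdate b (b k) (k - 1) →
    β k ≤ δ / 6 * √(Lk (lastUpdate b (b k) (k - 1)) / Lk k)
  step_off : ∀ k, 1 ≤ k → AgreeOff blk (b k) (x k) (x (k - 1))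
  step_min : ∀ k, 1 ≤ k → ∀ z,
    subproblem blk f (b k) (extrapolated blk b β x k) (1 / (2 * Lk k))
        (weight lam p (x (k - 1)) (ε (k - 1))) (x k) ≤
      subproblem blk f (b k) (extrapolated blk b β x k) (1 / (2 * Lk k))
        (weight lam p (x (k - 1)) (ε (k - 1))) z
  eps_zero : ∀ k j, x (k + 1) j = 0 → ε (k + 1) j = ε k j
  eps_nonzero : ∀ k j, x (k + 1) j ≠ 0 → 0 < ε (k + 1) j ∧ ε (k + 1) j ≤ √μ * ε k j

/-- Every block is updated at least once within any `T` consecutive iterations. -/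
def EssentiallyCyclic (b : ℕ → Fin m) (T : ℕ) : Prop :=
  ∀ k i, ∃ κ, k + 1 ≤ κ ∧ κ ≤ k + T ∧ b κ = i

open Classical in
/-- The index set `I*` of the coordinates that are nonzero for all large `k`. -/
noncomputable def limitSupport (x : ℕ → EuclideanSpace ℝ (Fin n)) : Finset (Fin n) :=
  Finset.univ.filter fun j => ∀ᶠ k in atTop, x k j ≠ 0

/-- Extension by `0` of a vector indexed by `I`. -/
noncomputable def extendZero (I : Finset (Fin n)) (v : I → ℝ) : EuclideanSpace ℝ (Fin n) :=
  WithLp.toLp 2 fun j => if h : j ∈ I then v ⟨j, h⟩ else 0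

/-- The reduced objective `(x_I, ε_I) ↦ f(x_I, 0) + λ ∑_{i ∈ I} (|xᵢ| + εᵢ²)^p` on `ℝ^{2|I|}`; the
left summand of `I ⊕ I` indexes `x_I`, the right one `ε_I`. -/
noncomputable def reducedObjective (f : EuclideanSpace ℝ (Fin n) → ℝ) (lam p : ℝ)
    (I : Finset (Fin n)) (z : EuclideanSpace ℝ (I ⊕ I)) : ℝ :=
  f (extendZero I fun i => z (Sum.inl i)) +
    lam * ∑ i : I, (|z (Sum.inl i)| + z (Sum.inr i) ^ 2) ^ p

/-- The point `(x_I, 0_I)` of `ℝ^{2|I|}`. -/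
noncomputable def reducedPoint (I : Finset (Fin n)) (x : EuclideanSpace ℝ (Fin n)) :
    EuclideanSpace ℝ (I ⊕ I) :=
  WithLp.toLp 2 (Sum.elim (fun i => x i) fun _ => 0)

/-- `∑_i ‖ε_{s_i ∩ I}‖₁`, where `ε_{s_i}` is the value of `ε` at the `d`-th update of the block
`s_i` and `d` is the number of updates of `s_i` in the iterations `1, …, k` (the initial value
if `d = 0`). -/
noncomputable def epsNorm (blk : Fin n → Fin m) (b : ℕ → Fin m) (ε : ℕ → Fin n → ℝ)
    (I : Finset (Fin n)) (k : ℕ) : ℝ :=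
  ∑ j ∈ I, |ε (lastUpdate b (blk j) k) j|

end Problem

end BPIRe

/-!
The proof is a Kurdyka–Łojasiewicz argument along the iterates, in which only the nonzero
coordinates and the reduced objective `J` on them matter in the end.

*Descent.* Comparing `x^{k+1}` with `x^k` in the subproblem, and using the block descent lemma and
the concavity of `t ↦ t ^ p`, one finds that the objective decreases up to an extrapolation error.
The bound on `β_k` makes this error at most `δ / 4` times the weighted squares of the current step
and of the previous step of the same block, so the objective plus a quarter of the weighted squared
last steps of all blocks is a Lyapunov function (`lyapunov_decrease`). Hence the steps tend to `0`.

*Support.* A coordinate that is nonzero after an update has a bounded weight, so its smoothed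
modulus before the update is bounded below (`exists_lower_bound`). Since `ε_j` tends to `0` for a
coordinate that is nonzero infinitely often, each coordinate is eventually zero, or eventually
bounded away from `0` with `ε_j` geometrically small (`eventually_eq_zero`, `exists_le_abs`,
`exists_eps_le_pow`). So late iterates lie where `J` is differentiable, and the objective differs
from `J` by a constant (`exists_objective_eq`).

*Łojasiewicz inequality.* By the optimality conditions of the last updates, the gradient of `J` at
an iterate near the limit point is bounded by the length of the last `2 T` steps plus a geometric
term (`exists_norm_reducedGradient_le`). The geometric terms are absorbed by adding `√μ ^ k` to the
steps and its square to the Lyapunov function (`gap`), and the KL property yields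
`gap k ^ max θ (1 / 2) ≤ C * (length of the last 2 T steps)` (`exists_gap_rpow_le`).

*Rates.* Summing over batches of `2 T` iterations reduces the convergence to the classical situation
of one step per inequality: the iterates are trapped near the limit point, their distance to it is
at most a power of the value at the start of the batch, and these values satisfy a recursion whose
solutions decay geometrically or like a power (`exists_batch_bound`, `le_pow_of_recursion`,
`le_rpow_of_recursion`). The term in `ε` is `O(√μ ^ k)` and is dominated by either rate
(`exists_rate_of_isBigO`).

*The exponent `θ = 0`.* Then the gradient of `J` is bounded away from `0` wherever `J` exceeds its
limit value. But at `(x^k, ε^{k-1})` it does exceed it, because the smoothing parameters strictly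
decrease, while the gradient tends to `0` along a subsequence. So the limit support is empty and the
iterates are eventually `0` (`limitSupport_eq_empty`).
-/

namespace BPIRe

/-! ### Sequences with sufficient decrease and a Łojasiewicz inequality -/

/-- A concave power lies below its tangents. -/
lemma rpow_le_tangent {p a b : ℝ} (hp0 : 0 ≤ p) (hp1 : p ≤ 1) (ha : 0 < a) (hb : 0 ≤ b) :
    b ^ p ≤ a ^ p + p * a ^ (p - 1) * (b - a) := by
  have h := rpow_one_add_le_one_add_mul_self (s := b / a - 1)
    (by have := div_nonneg hb ha.le; linarith) hp0 hp1
  have h1 : (1 : ℝ) + (b / a - 1) = b / a := by ring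
  rw [h1, Real.div_rpow hb ha.le, div_le_iff₀ (Real.rpow_pos_of_pos ha p)] at h
  rw [Real.rpow_sub_one ha.ne']
  calc b ^ p ≤ _ := h
    _ = _ := by field_simp

/-- The concavity inequality for the desingularizing function `s ↦ s ^ (1 - θ)`, multiplied by
`s ^ θ` so that it also holds at `s = 0`. -/
lemma one_sub_mul_sub_le {θ s t : ℝ} (h0 : 0 ≤ θ) (h1 : θ < 1) (ht : 0 ≤ t) (hts : t ≤ s) :
    (1 - θ) * (s - t) ≤ s ^ θ * (s ^ (1 - θ) - t ^ (1 - θ)) := by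
  rcases (ht.trans hts).eq_or_lt with hs | hs
  · have : t = s := by linarith
    simp [this]
  · have h := rpow_le_tangent (p := 1 - θ) (by linarith) (by linarith) hs ht
    have h2 : s ^ θ * s ^ (1 - θ - 1) = 1 := by
      rw [← Real.rpow_add hs]; simp
    have h3 := mul_le_mul_of_nonneg_left h (Real.rpow_nonneg hs.le θ)
    have h4 : s ^ θ * (s ^ (1 - θ) + (1 - θ) * s ^ (1 - θ - 1) * (t - s)) =
        s ^ θ * s ^ (1 - θ) + (s ^ θ * s ^ (1 - θ - 1)) * ((1 - θ) * (t - s)) := by ring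
    rw [h4, h2] at h3
    linarith

/-- The telescoping argument of Kurdyka–Łojasiewicz theory: sufficient decrease of the values `A`
together with `A_{q+1} ^ θ ≤ C * E_q` bounds the length `∑ E_q`. -/
lemma sum_le_of_decrease {A E : ℕ → ℝ} {γ C θ : ℝ} (hγ : 0 < γ) (hC : 0 < C) (h0 : 0 ≤ θ)
    (h1 : θ < 1) (hA : ∀ q, 0 ≤ A q) (hE : ∀ q, 0 ≤ E q)
    (hdec : ∀ q, γ * E q ^ 2 ≤ A q - A (q + 1)) {Q M : ℕ} (hQM : Q ≤ M)
    (hKL : ∀ q, Q ≤ q → q < M → A (q + 1) ^ θ ≤ C * E q) :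
    ∑ q ∈ Finset.Ico Q (M + 1), E q + E M + C / (γ * (1 - θ)) * A (M + 1) ^ (1 - θ) ≤
      2 * E Q + C / (γ * (1 - θ)) * A (Q + 1) ^ (1 - θ) := by
  induction M, hQM using Nat.le_induction with
  | base => simp; linarith
  | succ M hQM ih =>
    have ih := ih fun q hq hqM => hKL q hq (by omega)
    rw [Finset.sum_Ico_succ_top (by omega)]
    have hk := hKL M hQM (by omega)
    have hd := hdec (M + 1)
    have hmono : A (M + 1 + 1) ≤ A (M + 1) := by
      have := mul_nonneg hγ.le (sq_nonneg (E (M + 1))); linarith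
    have ht := one_sub_mul_sub_le h0 h1 (hA (M + 1 + 1)) hmono
    set φ := A (M + 1) ^ (1 - θ)
    set φ' := A (M + 1 + 1) ^ (1 - θ)
    have hφ : φ' ≤ φ := Real.rpow_le_rpow (hA _) hmono (by linarith)
    have h1' : 0 < 1 - θ := by linarith
    have key : E (M + 1) ^ 2 ≤ E M * (C / (γ * (1 - θ)) * (φ - φ')) := by
      have h2 : (1 - θ) * (γ * E (M + 1) ^ 2) ≤ C * E M * (φ - φ') :=
        calc _ ≤ (1 - θ) * (A (M + 1) - A (M + 1 + 1)) := by gcongr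
          _ ≤ _ := ht
          _ ≤ _ := mul_le_mul_of_nonneg_right hk (by linarith)
      have h3 : E M * (C / (γ * (1 - θ)) * (φ - φ')) = (C * E M * (φ - φ')) / (γ * (1 - θ)) := by
        field_simp
      rw [h3, le_div_iff₀ (by positivity)]
      linarith
    have hX : 0 ≤ C / (γ * (1 - θ)) * (φ - φ') :=
      mul_nonneg (by positivity) (by linarith)
    set X := C / (γ * (1 - θ)) * (φ - φ') with hXdef
    -- arithmetic-geometric mean: `E (M + 1) ^ 2 ≤ E M * X` gives `2 * E (M + 1) ≤ E M + X`
    have h2E : 2 * E (M + 1) ≤ E M + X := by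
      refine abs_le_of_sq_le_sq' ?_ (add_nonneg (hE M) hX) |>.2
      nlinarith [sq_nonneg (E M - X)]
    have : X = C / (γ * (1 - θ)) * φ - C / (γ * (1 - θ)) * φ' := by rw [hXdef]; ring
    linarith

/-- The length bound in terms of `A Q` alone; `1 / 2 ≤ θ` and `A Q ≤ 1` make `√(A Q)`, the bound for
the first step, at most `A Q ^ (1 - θ)`. -/
lemma sum_le_rpow_of_decrease {A E : ℕ → ℝ} {γ C θ : ℝ} (hγ : 0 < γ) (hC : 0 < C)
    (h0 : 1 / 2 ≤ θ) (h1 : θ < 1) (hA : ∀ q, 0 ≤ A q) (hE : ∀ q, 0 ≤ E q)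
    (hdec : ∀ q, γ * E q ^ 2 ≤ A q - A (q + 1)) {Q M : ℕ} (hQM : Q ≤ M) (hAQ : A Q ≤ 1)
    (hKL : ∀ q, Q ≤ q → q < M → A (q + 1) ^ θ ≤ C * E q) :
    ∑ q ∈ Finset.Ico Q (M + 1), E q ≤ (2 / √γ + C / (γ * (1 - θ))) * A Q ^ (1 - θ) := by
  have h := sum_le_of_decrease hγ hC (by linarith) h1 hA hE hdec hQM hKL
  have h1' : 0 < 1 - θ := by linarith
  have hD : 0 ≤ C / (γ * (1 - θ)) := by positivity
  have hmono : A (Q + 1) ≤ A Q := by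
    have := mul_nonneg hγ.le (sq_nonneg (E Q)); have := hdec Q; linarith
  have hp : A (Q + 1) ^ (1 - θ) ≤ A Q ^ (1 - θ) := Real.rpow_le_rpow (hA _) hmono h1'.le
  have hEQ : E Q ≤ 1 / √γ * A Q ^ (1 - θ) := by
    have h2 : E Q ≤ √(A Q / γ) := by
      apply Real.le_sqrt_of_sq_le
      rw [le_div_iff₀ hγ]
      have := hdec Q; have := hA (Q + 1); linarith
    have h3 : √(A Q) ≤ A Q ^ (1 - θ) := by
      rw [Real.sqrt_eq_rpow]
      rcases (hA Q).eq_or_lt with h | h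
      · rw [← h, Real.zero_rpow (by norm_num)]; exact Real.rpow_nonneg le_rfl _
      · exact Real.rpow_le_rpow_of_exponent_ge h hAQ (by linarith)
    rw [Real.sqrt_div (hA Q)] at h2
    calc E Q ≤ _ := h2
      _ = 1 / √γ * √(A Q) := by ring
      _ ≤ _ := by gcongr
  have h5 := mul_le_mul_of_nonneg_left hp hD
  have h6 : 0 ≤ C / (γ * (1 - θ)) * A (M + 1) ^ (1 - θ) :=
    mul_nonneg hD (Real.rpow_nonneg (hA _) _)
  have h7 : 2 / √γ = 2 * (1 / √γ) := by ring
  have := hE M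
  rw [h7]
  nlinarith

/-- Trapping: a sequence that starts close enough to `xs`, relative to its initial value `A 0`,
stays in the ball on which the Łojasiewicz inequality is available. -/
lemma dist_lt_of_decrease {X : Type*} [PseudoMetricSpace X] {y : ℕ → X} {xs : X}
    {A E : ℕ → ℝ} {γ C θ r : ℝ} (hγ : 0 < γ) (hC : 0 < C)
    (h0 : 1 / 2 ≤ θ) (h1 : θ < 1) (hA : ∀ q, 0 ≤ A q) (hE : ∀ q, 0 ≤ E q)
    (hdec : ∀ q, γ * E q ^ 2 ≤ A q - A (q + 1)) (hy : ∀ q, dist (y q) (y (q + 1)) ≤ E q)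
    (hKL : ∀ q, dist (y (q + 1)) xs < r → A (q + 1) ^ θ ≤ C * E q) (hA0 : A 0 ≤ 1)
    (hstart : dist (y 0) xs + (2 / √γ + C / (γ * (1 - θ))) * A 0 ^ (1 - θ) < r) (q : ℕ) :
    dist (y q) xs < r := by
  induction q using Nat.strong_induction_on with
  | _ q ih =>
    have h1' : 0 < 1 - θ := by linarith
    rcases q with _ | M
    · have : 0 ≤ (2 / √γ + C / (γ * (1 - θ))) * A 0 ^ (1 - θ) :=
        mul_nonneg (by positivity) (Real.rpow_nonneg (hA 0) _)
      linarith
    · have h := sum_le_rpow_of_decrease hγ hC h0 h1 hA hE hdec (Nat.zero_le M) hA0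
        fun q _ hq => hKL q (ih (q + 1) (by omega))
      have h2 : dist (y 0) (y (M + 1)) ≤ ∑ q ∈ Finset.Ico 0 (M + 1), E q :=
        (dist_le_Ico_sum_dist y (Nat.zero_le _)).trans (Finset.sum_le_sum fun i _ => hy i)
      have h3 := dist_triangle_left (y (M + 1)) xs (y 0)
      linarith

lemma sq_sum_le_of_decrease {Ψ e : ℕ → ℝ} {γ : ℝ} (hγ : 0 < γ)
    (hdec : ∀ k, γ * e k ^ 2 ≤ Ψ k - Ψ (k + 1))
    (k N : ℕ) :
    γ * (∑ s ∈ Finset.Ico k (k + N), e s) ^ 2 ≤ N * (Ψ k - Ψ (k + N)) := by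
  have h1 := sq_sum_le_card_mul_sum_sq (s := Finset.Ico k (k + N)) (f := e)
  have h2 : γ * ∑ s ∈ Finset.Ico k (k + N), e s ^ 2 ≤ Ψ k - Ψ (k + N) := by
    rw [Finset.mul_sum]
    calc _ ≤ ∑ s ∈ Finset.Ico k (k + N), (Ψ s - Ψ (s + 1)) := Finset.sum_le_sum fun s _ => hdec s
      _ = _ := by
        rw [← neg_inj, ← Finset.sum_neg_distrib]
        simpa using Finset.sum_Ico_sub Ψ (Nat.le_add_right k N)
  simp only [Nat.card_Ico, add_tsub_cancel_left] at h1
  calc _ ≤ γ * (N * ∑ s ∈ Finset.Ico k (k + N), e s ^ 2) := by gcongr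
    _ = N * (γ * ∑ s ∈ Finset.Ico k (k + N), e s ^ 2) := by ring
    _ ≤ _ := by gcongr

lemma sum_Ico_batches (e : ℕ → ℝ) (K N Q M : ℕ) (hQM : Q ≤ M) :
    ∑ q ∈ Finset.Ico Q M, ∑ s ∈ Finset.Ico (K + q * N) (K + q * N + N), e s =
      ∑ s ∈ Finset.Ico (K + Q * N) (K + M * N), e s := by
  induction M, hQM using Nat.le_induction with
  | base => simp
  | succ M hQM ih =>
    have h1 : K + Q * N ≤ K + M * N := by gcongr
    have h2 : K + (M + 1) * N = K + M * N + N := by ring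
    rw [Finset.sum_Ico_succ_top hQM, ih, h2,
      Finset.sum_Ico_consecutive e h1 (Nat.le_add_right _ _)]

/-- Convergence of a sequence under sufficient decrease of `Ψ` and a Łojasiewicz inequality whose
right-hand side is the length of the last `N` steps. Grouping the iterations into batches of
length `N` reduces this to `dist_lt_of_decrease`; the distance to the limit is bounded by the value
at the beginning of the batch, and these values satisfy a recursion that determines the rate. -/
theorem exists_batch_bound {X : Type*} [PseudoMetricSpace X] {x : ℕ → X} {xs : X}
    {Ψ e : ℕ → ℝ} {N : ℕ} {γ C θ r : ℝ} (hN : 0 < N) (hγ : 0 < γ) (hC : 0 < C)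
    (h0 : 1 / 2 ≤ θ) (h1 : θ < 1) (hr : 0 < r) (hΨ : ∀ k, 0 ≤ Ψ k) (he : ∀ k, 0 ≤ e k)
    (hdec : ∀ k, γ * e k ^ 2 ≤ Ψ k - Ψ (k + 1)) (hΨ0 : Tendsto Ψ atTop (𝓝 0))
    (hx : ∀ k, dist (x k) (x (k + 1)) ≤ e k) (hxs : MapClusterPt xs atTop x)
    (hKL : ∀ᶠ k in atTop, dist (x k) xs < r → Ψ k ^ θ ≤ C * ∑ s ∈ Finset.Ico (k - N) k, e s) :
    ∃ (K : ℕ) (B D : ℝ), 0 < B ∧ 0 < D ∧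
      (∀ q k, K + q * N ≤ k → dist (x k) xs ≤ B * Ψ (K + q * N) ^ (1 - θ)) ∧
      ∀ q, Ψ (K + (q + 1) * N) ^ (2 * θ) ≤ D * (Ψ (K + q * N) - Ψ (K + (q + 1) * N)) := by
  have h1' : 0 < 1 - θ := by linarith
  have hN' : (0 : ℝ) < N := by exact_mod_cast hN
  obtain ⟨K₀, hK₀⟩ := eventually_atTop.1 hKL
  set γ' := γ / N with hγ'
  have hγ'pos : 0 < γ' := by positivity
  set B := 2 / √γ' + C / (γ' * (1 - θ)) with hB
  have hBpos : 0 < B := by positivity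
  have hsmall : ∀ᶠ k in atTop, B * Ψ k ^ (1 - θ) < r / 2 ∧ Ψ k ≤ 1 := by
    have ht : Tendsto (fun k => B * Ψ k ^ (1 - θ)) atTop (𝓝 0) := by
      have := (hΨ0.rpow_const (p := 1 - θ) (Or.inr h1'.le)).const_mul B
      rwa [Real.zero_rpow h1'.ne', mul_zero] at this
    exact (ht.eventually_lt_const (by linarith)).and (hΨ0.eventually_le_const one_pos)
  have hfreq : ∃ᶠ k in atTop, dist (x k) xs < r / 2 :=
    hxs.frequently (Metric.ball_mem_nhds xs (by linarith : 0 < r / 2))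
  -- the batches begin at an iterate close to `xs` whose value is small enough for trapping
  obtain ⟨K, hK1, ⟨hK2, hK3⟩, hK4⟩ :=
    (hfreq.and_eventually (hsmall.and (eventually_ge_atTop K₀))).exists
  set A : ℕ → ℝ := fun q => Ψ (K + q * N) with hAdef
  set E : ℕ → ℝ := fun q => ∑ s ∈ Finset.Ico (K + q * N) (K + q * N + N), e s with hEdef
  have hsucc : ∀ q, K + (q + 1) * N = K + q * N + N := fun q => by ring
  have hE : ∀ q, 0 ≤ E q := fun q => Finset.sum_nonneg fun s _ => he s
  have hA : ∀ q, 0 ≤ A q := fun q => hΨ _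
  have hdecA : ∀ q, γ' * E q ^ 2 ≤ A q - A (q + 1) := by
    intro q
    have := sq_sum_le_of_decrease hγ hdec (K + q * N) N
    simp only [hAdef, hsucc, hγ']
    rw [div_mul_eq_mul_div, div_le_iff₀ hN']
    linarith
  have hy : ∀ q, dist (x (K + q * N)) (x (K + (q + 1) * N)) ≤ E q := fun q => by
    rw [hsucc]
    exact (dist_le_Ico_sum_dist x (Nat.le_add_right _ _)).trans
      (Finset.sum_le_sum fun i _ => hx i)
  have hKL' : ∀ q, dist (x (K + (q + 1) * N)) xs < r → A (q + 1) ^ θ ≤ C * E q := by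
    intro q hq
    have := hK₀ (K + (q + 1) * N) (by omega) hq
    simpa [hAdef, hEdef, hsucc] using this
  have hA0 : A 0 ≤ 1 := by simpa [hAdef] using hK3
  have htrap := dist_lt_of_decrease (y := fun q => x (K + q * N)) hγ'pos hC h0 h1 hA hE hdecA hy
    hKL' hA0 (by simp only [hAdef, zero_mul, add_zero]; linarith)
  have hKLall : ∀ q, A (q + 1) ^ θ ≤ C * E q := fun q => hKL' q (htrap (q + 1))
  have hAanti : Antitone A := antitone_nat_of_succ_le fun q => by
    have := hdecA q; have := mul_nonneg hγ'pos.le (sq_nonneg (E q)); linarith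
  refine ⟨K, B, C ^ 2 / γ', hBpos, by positivity, ?_, ?_⟩
  · intro q k hk
    have hAq : A q ≤ 1 := (hAanti (Nat.zero_le q)).trans hA0
    have hlen : ∀ l, k ≤ l → dist (x k) (x l) ≤ B * A q ^ (1 - θ) := by
      intro l hl
      have hlq : q ≤ l := by
        have : q ≤ q * N := Nat.le_mul_of_pos_right q hN
        omega
      have hlN : l ≤ l * N := Nat.le_mul_of_pos_right l hN
      calc dist (x k) (x l) ≤ ∑ s ∈ Finset.Ico k l, e s :=
            (dist_le_Ico_sum_dist x hl).trans (Finset.sum_le_sum fun i _ => hx i)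
        _ ≤ ∑ s ∈ Finset.Ico (K + q * N) (K + (l + 1) * N), e s := by
            refine Finset.sum_le_sum_of_subset_of_nonneg (Finset.Ico_subset_Ico hk ?_)
              fun i _ _ => he i
            rw [hsucc]; omega
        _ = ∑ q ∈ Finset.Ico q (l + 1), E q := (sum_Ico_batches e K N q (l + 1) (by omega)).symm
        _ ≤ _ := sum_le_rpow_of_decrease hγ'pos hC h0 h1 hA hE hdecA hlq hAq
            fun q _ _ => hKLall q
    -- later iterates come arbitrarily close to `xs`
    refine le_of_forall_pos_le_add fun η hη => ?_
    obtain ⟨l, hl1, hl2⟩ := ((hxs.frequently (Metric.ball_mem_nhds xs hη)).and_eventually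
      (eventually_ge_atTop k)).exists
    have := dist_triangle (x k) (x l) xs
    have := hlen l hl2
    have hl1 : dist (x l) xs < η := hl1
    linarith
  · intro q
    have h2 : A (q + 1) ^ (2 * θ) = (A (q + 1) ^ θ) ^ 2 := by
      rw [mul_comm, Real.rpow_mul (hA _)]; norm_cast
    have h3 : (A (q + 1) ^ θ) ^ 2 ≤ (C * E q) ^ 2 :=
      pow_le_pow_left₀ (Real.rpow_nonneg (hA _) _) (hKLall q) 2
    change A (q + 1) ^ (2 * θ) ≤ C ^ 2 / γ' * (A q - A (q + 1))
    rw [h2, div_mul_eq_mul_div, le_div_iff₀ hγ'pos]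
    have := hdecA q
    nlinarith [sq_nonneg C]

lemma le_pow_of_recursion {A : ℕ → ℝ} {D : ℝ} (hD : 0 < D)
    (h : ∀ q, A (q + 1) ≤ D * (A q - A (q + 1))) (q : ℕ) : A q ≤ A 0 * (D / (1 + D)) ^ q := by
  induction q with
  | zero => simp
  | succ q ih =>
    have h1 : A (q + 1) ≤ D / (1 + D) * A q := by
      rw [div_mul_eq_mul_div, le_div_iff₀ (by linarith)]
      have := h q; linarith
    calc _ ≤ _ := h1
      _ ≤ D / (1 + D) * (A 0 * (D / (1 + D)) ^ q) := by gcongr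
      _ = _ := by ring

/-- Sublinear decay from `A_{q+1} ^ (1 + σ⁻¹) ≤ D (A_q - A_{q+1})`, by induction: if `A_{q+1}`
exceeded `M (q+2)^{-σ}`, the recursion would push `A_q` above `M (q+1)^{-σ}`. -/
lemma le_rpow_of_recursion {A : ℕ → ℝ} {D σ : ℝ} (hD : 0 < D) (hσ : 0 < σ)
    (h : ∀ q, A (q + 1) ^ (1 + σ⁻¹) ≤ D * (A q - A (q + 1))) :
    ∃ M : ℝ, 0 < M ∧ ∀ q : ℕ, A q ≤ M * ((q : ℝ) + 1) ^ (-σ) := by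
  have hσi : 0 < σ⁻¹ := inv_pos.2 hσ
  -- `M₁` satisfies `M₁ ^ σ⁻¹ = D * (σ * 2 ^ (σ + 1))`, which balances the recursion against the
  -- decrease of `(q + 1) ^ (-σ)`
  set M₁ := (D * (σ * 2 ^ (σ + 1))) ^ σ with hM₁
  have hM₁pos : 0 < M₁ := by positivity
  have hM₁' : M₁ ^ σ⁻¹ = D * (σ * 2 ^ (σ + 1)) := Real.rpow_rpow_inv (by positivity) hσ.ne'
  refine ⟨max M₁ (A 0), lt_max_of_lt_left hM₁pos, ?_⟩
  set M := max M₁ (A 0)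
  have hM : 0 < M := lt_max_of_lt_left hM₁pos
  intro q
  induction q with
  | zero => simp [M]
  | succ q ih =>
    by_contra! hlt
    have ha : (0 : ℝ) < (q : ℝ) + 1 := by positivity
    push_cast at hlt
    set a : ℝ := (q : ℝ) + 1 with hadef
    have ha1 : 1 ≤ a := by simp [hadef]
    -- `a ^ (-σ) - (a + 1) ^ (-σ) ≤ σ a ^ (-σ - 1)` is Bernoulli's inequality
    have hbern : a ^ (-σ) - (a + 1) ^ (-σ) ≤ σ * (2 ^ (σ + 1) * (a + 1) ^ (-σ - 1)) := by
      have h1 : a ^ (-σ) * (1 - σ * a⁻¹) ≤ (a + 1) ^ (-σ) := by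
        have h2 : a + 1 = a * (1 + a⁻¹) := by field_simp
        have h3 : 0 < 1 + a⁻¹ := by positivity
        rw [h2, Real.mul_rpow ha.le h3.le]
        gcongr
        rw [Real.rpow_def_of_pos h3]
        have h4 := Real.add_one_le_exp (Real.log (1 + a⁻¹) * -σ)
        have h5 := Real.log_le_sub_one_of_pos h3
        have h6 : σ * Real.log (1 + a⁻¹) ≤ σ * a⁻¹ := by gcongr; linarith
        linarith
      have h2 : a ^ (-σ) * a⁻¹ ≤ 2 ^ (σ + 1) * (a + 1) ^ (-σ - 1) := by
        rw [← Real.rpow_neg_one a, ← Real.rpow_add ha]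
        have h3 : (2 * a) ^ (-σ - 1) ≤ (a + 1) ^ (-σ - 1) :=
          Real.rpow_le_rpow_of_nonpos (by positivity) (by linarith) (by linarith)
        rw [Real.mul_rpow two_pos.le ha.le] at h3
        have h4 : (2 : ℝ) ^ (σ + 1) * 2 ^ (-σ - 1) = 1 := by
          rw [← Real.rpow_add two_pos]; simp
        calc a ^ (-σ + -1) = 2 ^ (σ + 1) * (2 ^ (-σ - 1) * a ^ (-σ - 1)) := by
              rw [← mul_assoc, h4, one_mul]; rfl
          _ ≤ _ := by gcongr
      have h3 := mul_le_mul_of_nonneg_left h2 hσ.le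
      linarith
    have h2 : M ^ (1 + σ⁻¹) * (a + 1) ^ (-σ - 1) ≤ A (q + 1) ^ (1 + σ⁻¹) := by
      have h3 : (M * (a + 1) ^ (-σ)) ^ (1 + σ⁻¹) = M ^ (1 + σ⁻¹) * (a + 1) ^ (-σ - 1) := by
        rw [Real.mul_rpow hM.le (by positivity), ← Real.rpow_mul (by positivity)]
        congr 2
        field_simp
        ring
      rw [← h3]
      exact Real.rpow_le_rpow (by positivity) hlt.le (by positivity)
    have h4 : M * (D * (σ * 2 ^ (σ + 1))) ≤ M ^ (1 + σ⁻¹) := by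
      rw [Real.rpow_add hM, Real.rpow_one, ← hM₁']
      gcongr
      exact le_max_left _ _
    have h5 := h q
    have h6 : M * (D * (σ * 2 ^ (σ + 1))) * (a + 1) ^ (-σ - 1) ≤ D * (A q - A (q + 1)) :=
      (mul_le_mul_of_nonneg_right h4 (by positivity)).trans (h2.trans h5)
    have h7 : M * (σ * (2 ^ (σ + 1) * (a + 1) ^ (-σ - 1))) ≤ A q - A (q + 1) := by
      refine le_of_mul_le_mul_left ?_ hD
      linarith
    have h8 := mul_le_mul_of_nonneg_left hbern hM.le
    have ih' : A q ≤ M * a ^ (-σ) := ih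
    linarith

/-! ### Rates of convergence -/

lemma isBigO_pow_of_batch_bound {u Ψ : ℕ → ℝ} {K N : ℕ} {B D : ℝ} (hN : 0 < N) (hB : 0 < B)
    (hD : 0 < D) (hu : ∀ k, 0 ≤ u k) (hΨ : ∀ k, 0 ≤ Ψ k)
    (hbound : ∀ q k, K + q * N ≤ k → u k ≤ B * Ψ (K + q * N) ^ (1 / 2 : ℝ))
    (hrec : ∀ q, Ψ (K + (q + 1) * N) ≤ D * (Ψ (K + q * N) - Ψ (K + (q + 1) * N))) :
    ∃ α : ℝ, 0 < α ∧ α < 1 ∧ u =O[atTop] fun k : ℕ => α ^ k := by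
  have hrate := le_pow_of_recursion (A := fun q => Ψ (K + q * N)) hD hrec
  simp only [zero_mul, add_zero] at hrate
  set τ := D / (1 + D)
  have hτ0 : 0 < τ := by positivity
  have hτ1 : τ < 1 := by rw [div_lt_one (by linarith)]; linarith
  -- the values contract by `τ` per batch, their square roots by `α` per iteration
  set α := τ ^ (1 / 2 / N : ℝ) with hα
  have hN' : (0 : ℝ) < N := by exact_mod_cast hN
  have hα0 : 0 < α := Real.rpow_pos_of_pos hτ0 _
  have hα1 : α < 1 := Real.rpow_lt_one hτ0.le hτ1 (by positivity)
  have hαN : α ^ N = τ ^ (1 / 2 : ℝ) := by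
    rw [hα, ← Real.rpow_natCast, ← Real.rpow_mul hτ0.le]
    congr 1; field_simp
  refine ⟨α, hα0, hα1, ?_⟩
  refine Asymptotics.IsBigO.of_bound (B * Ψ K ^ (1 / 2 : ℝ) * (α ^ (K + N))⁻¹) ?_
  filter_upwards [eventually_ge_atTop K] with k hk
  have hdm : N * ((k - K) / N) + (k - K) % N = k - K := Nat.div_add_mod _ _
  have hmod := Nat.mod_lt (k - K) hN
  set q := (k - K) / N
  have hcomm : N * q = q * N := mul_comm _ _
  rw [Real.norm_of_nonneg (hu k), Real.norm_of_nonneg (by positivity)]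
  calc u k ≤ B * Ψ (K + q * N) ^ (1 / 2 : ℝ) := hbound q k (by omega)
    _ ≤ B * (Ψ K * τ ^ q) ^ (1 / 2 : ℝ) := by
        gcongr
        · exact hΨ _
        · exact hrate q
    _ = B * Ψ K ^ (1 / 2 : ℝ) * α ^ (N * q) := by
        rw [Real.mul_rpow (hΨ _) (by positivity), pow_mul, hαN, ← Real.rpow_natCast (τ ^ _),
          ← Real.rpow_natCast τ, ← Real.rpow_mul hτ0.le, ← Real.rpow_mul hτ0.le,
          mul_comm (q : ℝ), mul_assoc]
    _ ≤ B * Ψ K ^ (1 / 2 : ℝ) * ((α ^ (K + N))⁻¹ * α ^ k) := by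
        have := Real.rpow_nonneg (hΨ K) (1 / 2)
        gcongr
        rw [le_inv_mul_iff₀ (by positivity), ← pow_add]
        exact pow_le_pow_of_le_one hα0.le hα1.le (by omega)
    _ = _ := by ring

lemma isBigO_rpow_of_batch_bound {u Ψ : ℕ → ℝ} {K N : ℕ} {B D θ : ℝ} (hN : 0 < N) (hB : 0 < B)
    (hD : 0 < D) (h0 : 1 / 2 < θ) (h1 : θ < 1) (hu : ∀ k, 0 ≤ u k) (hΨ : ∀ k, 0 ≤ Ψ k)
    (hbound : ∀ q k, K + q * N ≤ k → u k ≤ B * Ψ (K + q * N) ^ (1 - θ))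
    (hrec : ∀ q, Ψ (K + (q + 1) * N) ^ (2 * θ) ≤
      D * (Ψ (K + q * N) - Ψ (K + (q + 1) * N))) :
    u =O[atTop] fun k : ℕ => (k : ℝ) ^ (-(1 - θ) / (2 * θ - 1)) := by
  have hθ : 0 < 2 * θ - 1 := by linarith
  have hN' : (0 : ℝ) < N := by exact_mod_cast hN
  obtain ⟨M, hM, hrate⟩ := le_rpow_of_recursion (A := fun q => Ψ (K + q * N)) (σ := (2 * θ - 1)⁻¹)
    hD (inv_pos.2 hθ) (by simpa using hrec)
  set s := -(1 - θ) / (2 * θ - 1) with hs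
  have hs0 : s ≤ 0 := div_nonpos_of_nonpos_of_nonneg (by linarith) hθ.le
  refine Asymptotics.IsBigO.of_bound (B * M ^ (1 - θ) * (1 / (2 * N) : ℝ) ^ s) ?_
  filter_upwards [eventually_ge_atTop (2 * K + 1)] with k hk
  have hdm : N * ((k - K) / N) + (k - K) % N = k - K := Nat.div_add_mod _ _
  have hmod := Nat.mod_lt (k - K) hN
  set q := (k - K) / N
  have hcomm : N * q = q * N := mul_comm _ _
  have hk0 : (0 : ℝ) < k := by exact_mod_cast (by omega : 0 < k)
  rw [Real.norm_of_nonneg (hu k), Real.norm_of_nonneg (by positivity)]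
  have hq : 1 / (2 * N) * (k : ℝ) ≤ q + 1 := by
    have h2 : k ≤ 2 * N * (q + 1) := by
      have : 2 * N * (q + 1) = 2 * (q * N) + 2 * N := by ring
      omega
    have h3 : (k : ℝ) ≤ 2 * N * (q + 1) := by exact_mod_cast h2
    rw [one_div_mul_eq_div, div_le_iff₀ (by positivity)]
    linarith
  calc u k ≤ B * Ψ (K + q * N) ^ (1 - θ) := hbound q k (by omega)
    _ ≤ B * (M * ((q : ℝ) + 1) ^ (-(2 * θ - 1)⁻¹)) ^ (1 - θ) := by
        have := hrate q
        have := hΨ (K + q * N)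
        have : 0 ≤ 1 - θ := by linarith
        gcongr
    _ = B * M ^ (1 - θ) * ((q : ℝ) + 1) ^ s := by
        rw [Real.mul_rpow hM.le (by positivity), ← Real.rpow_mul (by positivity), mul_assoc, hs]
        congr 3
        rw [div_eq_mul_inv]; ring
    _ ≤ B * M ^ (1 - θ) * (1 / (2 * N) * (k : ℝ)) ^ s := by
        gcongr ?_ * ?_
        exact Real.rpow_le_rpow_of_nonpos (by positivity) hq hs0
    _ = _ := by rw [Real.mul_rpow (by positivity) hk0.le]; ring

lemma isBigO_pow_rpow {α : ℝ} (h0 : 0 < α) (h1 : α < 1) (s : ℝ) :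
    (fun k : ℕ => α ^ k) =O[atTop] fun k : ℕ => (k : ℝ) ^ s := by
  have h := (isLittleO_exp_neg_mul_rpow_atTop (neg_pos.2 (Real.log_neg h0 h1)) s).isBigO
    |>.comp_tendsto tendsto_natCast_atTop_atTop
  refine h.congr_left fun k => ?_
  simp only [Function.comp_apply, neg_neg]
  rw [← Real.rpow_def_of_pos h0, Real.rpow_natCast]

/-! ### Blocks of coordinates -/

lemma norm_le_sum_abs {ι : Type*} [Fintype ι] (v : EuclideanSpace ℝ ι) : ‖v‖ ≤ ∑ i, |v i| := by
  rw [EuclideanSpace.norm_eq, Real.sqrt_le_left (Finset.sum_nonneg fun i _ => abs_nonneg _)]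
  exact Finset.sum_sq_le_sq_sum_of_nonneg fun i _ => norm_nonneg _

lemma abs_apply_le_norm {ι : Type*} [Fintype ι] (v : EuclideanSpace ℝ ι) (i : ι) : |v i| ≤ ‖v‖ :=
  PiLp.norm_apply_le v i

section Block

variable {n m : ℕ} {blk : Fin n → Fin m} {i : Fin m}

lemma blockPart_apply (v : EuclideanSpace ℝ (Fin n)) (j : Fin n) :
    blockPart blk i v j = if blk j = i then v j else 0 := rfl

lemma norm_blockPart_le (v : EuclideanSpace ℝ (Fin n)) : ‖blockPart blk i v‖ ≤ ‖v‖ := by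
  rw [EuclideanSpace.norm_eq, EuclideanSpace.norm_eq]
  gcongr with j
  rw [blockPart_apply]
  split_ifs <;> simp

lemma AgreeOff.blockPart_sub {y z : EuclideanSpace ℝ (Fin n)} (h : AgreeOff blk i y z) :
    blockPart blk i (y - z) = y - z := by
  ext j
  rw [blockPart_apply]
  split_ifs with hj
  · rfl
  · simp [h j hj]

lemma AgreeOff.symm {y z : EuclideanSpace ℝ (Fin n)} (h : AgreeOff blk i y z) :
    AgreeOff blk i z y := fun j hj => (h j hj).symm

lemma AgreeOff.trans {y z w : EuclideanSpace ℝ (Fin n)} (h : AgreeOff blk i y z)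
    (h' : AgreeOff blk i z w) : AgreeOff blk i y w := fun j hj => (h j hj).trans (h' j hj)

lemma agreeOff_rfl {y : EuclideanSpace ℝ (Fin n)} : AgreeOff blk i y y := fun _ _ => rfl

lemma inner_blockPart_left (u v : EuclideanSpace ℝ (Fin n)) :
    inner ℝ (blockPart blk i u) (blockPart blk i v) = inner ℝ u (blockPart blk i v) := by
  simp only [PiLp.inner_apply, blockPart_apply]
  refine Finset.sum_congr rfl fun j _ => ?_
  split_ifs <;> simp

lemma inner_blockPart_of_agreeOff {y z : EuclideanSpace ℝ (Fin n)} (h : AgreeOff blk i y z)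
    (u : EuclideanSpace ℝ (Fin n)) : inner ℝ (blockPart blk i u) (y - z) = inner ℝ u (y - z) := by
  rw [← h.blockPart_sub, inner_blockPart_left]

lemma blockPart_sub (u v : EuclideanSpace ℝ (Fin n)) :
    blockPart blk i (u - v) = blockPart blk i u - blockPart blk i v := by
  ext j
  simp only [blockPart_apply, PiLp.sub_apply]
  split_ifs <;> simp

end Block

/-! ### Update times -/

section LastUpdate

variable {m : ℕ} {b : ℕ → Fin m} {i : Fin m} {k T : ℕ}

lemma lastUpdate_le : lastUpdate b i k ≤ k := Nat.findGreatest_le k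

lemma lastUpdate_spec (h : 1 ≤ lastUpdate b i k) : b (lastUpdate b i k) = i :=
  (Nat.findGreatest_of_ne_zero (P := fun κ => 1 ≤ κ ∧ b κ = i) (m := lastUpdate b i k) rfl
    (by omega)).2

lemma lastUpdate_succ (b : ℕ → Fin m) (i : Fin m) (k : ℕ) :
    lastUpdate b i (k + 1) = if b (k + 1) = i then k + 1 else lastUpdate b i k := by
  rw [lastUpdate, Nat.findGreatest_succ]
  simp [lastUpdate]

lemma le_lastUpdate {κ : ℕ} (h1 : 1 ≤ κ) (hk : κ ≤ k) (hb : b κ = i) : κ ≤ lastUpdate b i k :=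
  Nat.le_findGreatest hk ⟨h1, hb⟩

lemma lt_lastUpdate_add (h : EssentiallyCyclic b T) (i : Fin m) (hk : T ≤ k) :
    k < lastUpdate b i k + T := by
  obtain ⟨κ, h1, h2, h3⟩ := h (k - T) i
  have := le_lastUpdate (k := k) (by omega) (by omega) h3
  omega

lemma le_lastUpdate_add (h : EssentiallyCyclic b T) (i : Fin m) (k : ℕ) :
    k ≤ lastUpdate b i k + T := by
  rcases le_total T k with hk | hk
  · exact (lt_lastUpdate_add h i hk).le
  · omega

lemma EssentiallyCyclic.pos (h : EssentiallyCyclic b T) : 0 < T := by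
  obtain ⟨κ, h1, h2, -⟩ := h 0 (b 0)
  omega

end LastUpdate

/-! ### Descent of the Lyapunov function -/

/-- The quadratic upper bound for a function whose gradient is Lipschitz along a segment. -/
lemma le_add_inner_add_of_lipschitz {E : Type*} [NormedAddCommGroup E] [InnerProductSpace ℝ E]
    [CompleteSpace E] {f : E → ℝ} (hf : Differentiable ℝ f) {x d : E} {L : ℝ}
    (h : ∀ t ∈ Set.Ioo (0 : ℝ) 1, inner ℝ (gradient f (x + t • d) - gradient f x) d ≤
      L * t * ‖d‖ ^ 2) :
    f (x + d) ≤ f x + inner ℝ (gradient f x) d + L / 2 * ‖d‖ ^ 2 := by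
  have hd : ∀ t : ℝ, HasDerivAt (fun t : ℝ => f (x + t • d) - t * inner ℝ (gradient f x) d -
      L / 2 * t ^ 2 * ‖d‖ ^ 2) (inner ℝ (gradient f (x + t • d)) d - inner ℝ (gradient f x) d -
      L * t * ‖d‖ ^ 2) t := by
    intro t
    have h1 : HasDerivAt (fun t : ℝ => x + t • d) d t := by
      simpa using ((hasDerivAt_id t).smul_const d).const_add x
    have h2 := (hf (x + t • d)).hasGradientAt.hasFDerivAt.comp_hasDerivAt t h1
    simp only [InnerProductSpace.toDual_apply_apply] at h2
    have h3 := (h2.sub ((hasDerivAt_id t).mul_const (inner ℝ (gradient f x) d))).sub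
      ((((hasDerivAt_pow 2 t).const_mul (L / 2))).mul_const (‖d‖ ^ 2))
    refine h3.congr_deriv ?_
    rw [Nat.cast_two]
    ring
  have hanti := antitoneOn_of_deriv_nonpos (convex_Icc (0 : ℝ) 1)
    (fun t _ => (hd t).continuousAt.continuousWithinAt)
    (fun t _ => (hd t).differentiableAt.differentiableWithinAt)
    (fun t ht => by
      rw [interior_Icc] at ht
      rw [(hd t).deriv]
      have := h t ht
      rw [inner_sub_left] at this
      linarith)
  have := hanti (Set.left_mem_Icc.2 zero_le_one) (Set.right_mem_Icc.2 zero_le_one) zero_le_one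
  simp only [one_smul, zero_smul, add_zero] at this
  linarith

section Generated

variable {n m : ℕ} {blk : Fin n → Fin m} {f : EuclideanSpace ℝ (Fin n) → ℝ}
  {lam p ℓ L δ μ : ℝ} {T : ℕ} {b : ℕ → Fin m} {Lk β : ℕ → ℝ}
  {x : ℕ → EuclideanSpace ℝ (Fin n)} {ε : ℕ → Fin n → ℝ}

lemma eps_pos (hgen : IsGenerated blk f lam p ℓ L δ μ b Lk β x ε) (k : ℕ) (j : Fin n) :
    0 < ε k j := by
  induction k with
  | zero => exact hgen.eps_init j
  | succ k ih =>
    by_cases h : x (k + 1) j = 0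
    · rw [hgen.eps_zero k j h]; exact ih
    · exact (hgen.eps_nonzero k j h).1

lemma eps_succ_le (hμ : μ ∈ Set.Ioo (0 : ℝ) 1)
    (hgen : IsGenerated blk f lam p ℓ L δ μ b Lk β x ε) (k : ℕ) (j : Fin n) :
    ε (k + 1) j ≤ ε k j := by
  by_cases h : x (k + 1) j = 0
  · exact (hgen.eps_zero k j h).le
  · refine (hgen.eps_nonzero k j h).2.trans (mul_le_of_le_one_left (eps_pos hgen k j).le ?_)
    exact Real.sqrt_le_one.2 hμ.2.le

lemma eps_antitone (hμ : μ ∈ Set.Ioo (0 : ℝ) 1)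
    (hgen : IsGenerated blk f lam p ℓ L δ μ b Lk β x ε) (j : Fin n) :
    Antitone fun k => ε k j :=
  antitone_nat_of_succ_le fun k => eps_succ_le hμ hgen k j

/-- A coordinate keeps its value since the last update of its block. -/
lemma apply_lastUpdate (hgen : IsGenerated blk f lam p ℓ L δ μ b Lk β x ε) (k : ℕ) (j : Fin n) :
    x (lastUpdate b (blk j) k) j = x k j := by
  induction k with
  | zero => rw [Nat.le_zero.1 lastUpdate_le]
  | succ k ih =>
    rw [lastUpdate_succ]
    split_ifs with h
    · rfl
    · rw [ih]
      exact (hgen.step_off (k + 1) (by omega) j (Ne.symm h)).symm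

lemma extrapolated_succ (hgen : IsGenerated blk f lam p ℓ L δ μ b Lk β x ε) (k : ℕ) :
    extrapolated blk b β x (k + 1) = x k + β (k + 1) • blockPart blk (b (k + 1))
      (x (lastUpdate b (b (k + 1)) k) - x (lastUpdate b (b (k + 1)) k - 1)) := by
  rw [extrapolated]
  simp only [Nat.add_sub_cancel]
  congr 2
  ext j
  simp only [blockPart_apply, PiLp.sub_apply]
  split_ifs with h
  · rw [← apply_lastUpdate hgen k j, h]
  · rfl

lemma norm_extrapolated_sub_le (hgen : IsGenerated blk f lam p ℓ L δ μ b Lk β x ε) (k : ℕ) :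
    ‖extrapolated blk b β x (k + 1) - x k‖ ≤ β (k + 1) *
      ‖x (lastUpdate b (b (k + 1)) k) - x (lastUpdate b (b (k + 1)) k - 1)‖ := by
  have hβ := (hgen.beta_mem (k + 1) (by omega)).1
  rw [extrapolated_succ hgen, add_sub_cancel_left, norm_smul, Real.norm_of_nonneg hβ]
  gcongr
  exact norm_blockPart_le _

lemma agreeOff_extrapolated (hgen : IsGenerated blk f lam p ℓ L δ μ b Lk β x ε) (k : ℕ) :
    AgreeOff blk (b (k + 1)) (extrapolated blk b β x (k + 1)) (x k) := by
  intro j hj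
  simp [extrapolated_succ hgen, blockPart_apply, hj]

/-- The bound on the extrapolation parameter at the second update of a block forces `0 ≤ δ`. -/
lemma delta_nonneg (hℓ : 0 < ℓ) (hgen : IsGenerated blk f lam p ℓ L δ μ b Lk β x ε)
    (hcyc : EssentiallyCyclic b T) : 0 ≤ δ := by
  obtain ⟨κ, h1, -, -⟩ := hcyc 0 (b 0)
  obtain ⟨k, h2, h3, h4⟩ := hcyc T (b 0)
  have hκ : 1 ≤ lastUpdate b (b k) (k - 1) := by
    have := lt_lastUpdate_add hcyc (b k) (by omega : T ≤ k - 1)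
    omega
  have h5 := hgen.beta_le k (by omega) hκ
  have h6 := (hgen.beta_mem k (by omega)).1
  have h7 := hgen.lip_mem _ hκ
  have h8 := hgen.lip_mem k (by omega)
  have h9 : 0 < √(Lk (lastUpdate b (b k) (k - 1)) / Lk k) :=
    Real.sqrt_pos.2 (div_pos (by linarith) (by linarith))
  have h10 := nonneg_of_mul_nonneg_left (h6.trans h5) h9
  linarith

/-- The extrapolation error is controlled by the two steps involved. -/
lemma extrapolation_error_le (hℓ : 0 < ℓ) (hgen : IsGenerated blk f lam p ℓ L δ μ b Lk β x ε)
    (hcyc : EssentiallyCyclic b T) (k : ℕ) {t : ℝ} (ht : 0 ≤ t) :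
    3 * Lk (k + 1) * t * ‖extrapolated blk b β x (k + 1) - x k‖ ≤
      δ / 4 * (Lk (k + 1) * t ^ 2 + Lk (lastUpdate b (b (k + 1)) k) *
        ‖x (lastUpdate b (b (k + 1)) k) - x (lastUpdate b (b (k + 1)) k - 1)‖ ^ 2) := by
  have hδ := delta_nonneg hℓ hgen hcyc
  have h1 := norm_extrapolated_sub_le hgen k
  have hL := (hgen.lip_mem (k + 1) (by omega)).1
  have hβ := hgen.beta_le (k + 1) (by omega)
  simp only [Nat.add_sub_cancel] at hβ
  set κ := lastUpdate b (b (k + 1)) k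
  set D := ‖x κ - x (κ - 1)‖ with hD
  have hL0 : 0 < Lk (k + 1) := by linarith
  rcases Nat.eq_zero_or_pos κ with h0 | h0
  · have hD0 : D = 0 := by simp [hD, h0]
    rw [hD0, mul_zero] at h1
    rw [hD0, le_antisymm h1 (norm_nonneg _)]
    have : 0 ≤ Lk (k + 1) * t ^ 2 := by positivity
    simp only [mul_zero]
    nlinarith
  · have hLκ : 0 < Lk κ := by have := (hgen.lip_mem κ h0).1; linarith
    have hD0 : 0 ≤ D := norm_nonneg _
    have h2 : ‖extrapolated blk b β x (k + 1) - x k‖ ≤ δ / 6 * √(Lk κ / Lk (k + 1)) * D :=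
      h1.trans (by gcongr; exact hβ h0)
    rw [Real.sqrt_div hLκ.le] at h2
    have hs1 := Real.sq_sqrt hL0.le
    have hs2 := Real.sq_sqrt hLκ.le
    have hs0 : 0 < √(Lk (k + 1)) := Real.sqrt_pos.2 hL0
    set s₁ := √(Lk (k + 1))
    set s₂ := √(Lk κ)
    rw [← hs1, ← hs2]
    calc 3 * s₁ ^ 2 * t * _ ≤ 3 * s₁ ^ 2 * t * (δ / 6 * (s₂ / s₁) * D) := by gcongr
      _ = δ / 4 * (2 * (s₁ * t) * (s₂ * D)) := by field_simp; ring
      _ ≤ δ / 4 * ((s₁ * t) ^ 2 + (s₂ * D) ^ 2) := by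
        gcongr
        exact two_mul_le_add_sq _ _
      _ = _ := by ring

lemma gradient_lipschitz_step (hprob : ProblemAssumption blk f lam p ℓ L)
    (hgen : IsGenerated blk f lam p ℓ L δ μ b Lk β x ε) (k : ℕ) :
    f (x (k + 1)) ≤ f (x k) + inner ℝ (gradient f (x k)) (x (k + 1) - x k) +
      Lk (k + 1) / 2 * ‖x (k + 1) - x k‖ ^ 2 := by
  have hoff : AgreeOff blk (b (k + 1)) (x (k + 1)) (x k) := hgen.step_off (k + 1) (by omega)
  have h := le_add_inner_add_of_lipschitz (hprob.contDiff.differentiable one_ne_zero) (x := x k)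
    (d := x (k + 1) - x k) (L := Lk (k + 1)) fun t ht => by
      rw [← inner_blockPart_of_agreeOff hoff]
      have h1 := hgen.lip_spec (k + 1) (by omega) (x k + t • (x (k + 1) - x k)) (x k)
        (fun j hj => by simp [hoff j hj]) agreeOff_rfl
      rw [add_sub_cancel_left, norm_smul, Real.norm_of_nonneg ht.1.le] at h1
      refine (real_inner_le_norm _ _).trans ?_
      nlinarith [norm_nonneg (x (k + 1) - x k)]
  simpa using h

/-- The decrease of the smooth part and of the linearized penalty in one step; it uses only that
`x^{k+1}` is at least as good as `x^k` in the subproblem. -/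
lemma linearized_decrease (hprob : ProblemAssumption blk f lam p ℓ L)
    (hgen : IsGenerated blk f lam p ℓ L δ μ b Lk β x ε) (k : ℕ) :
    f (x (k + 1)) + ∑ j with blk j = b (k + 1), weight lam p (x k) (ε k) j * |x (k + 1) j| ≤
      f (x k) + ∑ j with blk j = b (k + 1), weight lam p (x k) (ε k) j * |x k j| -
        Lk (k + 1) / 2 * ‖x (k + 1) - x k‖ ^ 2 +
        3 * Lk (k + 1) * ‖x (k + 1) - x k‖ * ‖extrapolated blk b β x (k + 1) - x k‖ := by
  have hoff : AgreeOff blk (b (k + 1)) (x (k + 1)) (x k) := hgen.step_off (k + 1) (by omega)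
  have hoffy := agreeOff_extrapolated hgen k
  have hmin := hgen.step_min (k + 1) (by omega) (x k)
  have hdes := gradient_lipschitz_step hprob hgen k
  have hlip := hgen.lip_spec (k + 1) (by omega) (x k) (extrapolated blk b β x (k + 1))
    agreeOff_rfl hoffy
  have hL : 0 < Lk (k + 1) := by
    have := (hgen.lip_mem (k + 1) (by omega)).1; have := hprob.ell_pos; linarith
  simp only [subproblem, Nat.add_sub_cancel] at hmin
  set y := extrapolated blk b β x (k + 1)
  rw [(hoff.trans hoffy.symm).blockPart_sub, hoffy.symm.blockPart_sub] at hmin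
  set d := x (k + 1) - x k with hd
  have hcoef : 1 / (2 * (1 / (2 * Lk (k + 1)))) = Lk (k + 1) := by field_simp
  rw [hcoef] at hmin
  have h1 : inner ℝ (blockPart blk (b (k + 1)) (gradient f y))
      (blockPart blk (b (k + 1)) (x (k + 1))) - inner ℝ (blockPart blk (b (k + 1)) (gradient f y))
      (blockPart blk (b (k + 1)) (x k)) = inner ℝ (gradient f y) d := by
    rw [← inner_sub_right, ← blockPart_sub, hoff.blockPart_sub, inner_blockPart_of_agreeOff hoff]
  have h2 : inner ℝ (gradient f (x k)) d - inner ℝ (gradient f y) d ≤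
      Lk (k + 1) * ‖y - x k‖ * ‖d‖ := by
    rw [← inner_sub_left, ← inner_blockPart_of_agreeOff hoff, norm_sub_rev y]
    exact (real_inner_le_norm _ _).trans (by gcongr)
  have h3 : ‖x (k + 1) - y‖ ^ 2 = ‖d‖ ^ 2 - 2 * inner ℝ d (y - x k) + ‖x k - y‖ ^ 2 := by
    have : x (k + 1) - y = d - (y - x k) := by rw [hd]; abel
    rw [this, norm_sub_sq_real, norm_sub_rev y]
  have h4 : inner ℝ d (y - x k) ≤ ‖d‖ * ‖y - x k‖ := real_inner_le_norm _ _
  have h5 := mul_le_mul_of_nonneg_left h4 hL.le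
  rw [h3] at hmin
  linarith

/-- The penalty is majorized by its linearization in the moduli, and smaller smoothing parameters
decrease it further. -/
lemma penalty_le (hprob : ProblemAssumption blk f lam p ℓ L) (hμ : μ ∈ Set.Ioo (0 : ℝ) 1)
    (hgen : IsGenerated blk f lam p ℓ L δ μ b Lk β x ε) (k : ℕ) :
    lam * ∑ j, (|x (k + 1) j| + ε (k + 1) j ^ 2) ^ p ≤ lam * ∑ j, (|x k j| + ε k j ^ 2) ^ p +
      ∑ j with blk j = b (k + 1), weight lam p (x k) (ε k) j * |x (k + 1) j| -
      ∑ j with blk j = b (k + 1), weight lam p (x k) (ε k) j * |x k j| := by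
  have hoff : AgreeOff blk (b (k + 1)) (x (k + 1)) (x k) := hgen.step_off (k + 1) (by omega)
  have hp := hprob.p_pos
  have h1 : ∀ j, lam * (|x (k + 1) j| + ε (k + 1) j ^ 2) ^ p ≤ lam * (|x k j| + ε k j ^ 2) ^ p +
      weight lam p (x k) (ε k) j * (|x (k + 1) j| - |x k j|) := by
    intro j
    have he := eps_pos hgen k j
    have he' := eps_pos hgen (k + 1) j
    have hle := eps_succ_le hμ hgen k j
    have h2 : (|x (k + 1) j| + ε (k + 1) j ^ 2) ^ p ≤ (|x (k + 1) j| + ε k j ^ 2) ^ p := by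
      gcongr
    have h3 := rpow_le_tangent (p := p) (a := |x k j| + ε k j ^ 2)
      (b := |x (k + 1) j| + ε k j ^ 2) hp.le hprob.p_lt_one.le (by positivity) (by positivity)
    have h4 := mul_le_mul_of_nonneg_left (h2.trans h3) hprob.lam_pos.le
    rw [weight]
    linarith
  have h5 : ∑ j with blk j = b (k + 1), weight lam p (x k) (ε k) j * |x (k + 1) j| -
      ∑ j with blk j = b (k + 1), weight lam p (x k) (ε k) j * |x k j| =
      ∑ j, weight lam p (x k) (ε k) j * (|x (k + 1) j| - |x k j|) := by
    rw [← Finset.sum_sub_distrib, Finset.sum_filter]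
    refine Finset.sum_congr rfl fun j _ => ?_
    split_ifs with h
    · ring
    · rw [hoff j h]; ring
  rw [add_sub_assoc, h5, Finset.mul_sum, Finset.mul_sum, ← Finset.sum_add_distrib]
  exact Finset.sum_le_sum fun j _ => h1 j

lemma objective_decrease (hprob : ProblemAssumption blk f lam p ℓ L) (hμ : μ ∈ Set.Ioo (0 : ℝ) 1)
    (hgen : IsGenerated blk f lam p ℓ L δ μ b Lk β x ε) (k : ℕ) :
    objective f lam p (x (k + 1)) (ε (k + 1)) ≤ objective f lam p (x k) (ε k) -
        Lk (k + 1) / 2 * ‖x (k + 1) - x k‖ ^ 2 +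
        3 * Lk (k + 1) * ‖x (k + 1) - x k‖ * ‖extrapolated blk b β x (k + 1) - x k‖ := by
  have h1 := linearized_decrease hprob hgen k
  have h2 := penalty_le hprob hμ hgen k
  simp only [objective]
  linarith

/-- The Lyapunov function: the objective plus, for each block, the weighted square of the step of
its last update. Every block that has not been updated yet contributes `0`, because
`lastUpdate` is then `0` and `x 0 - x (0 - 1) = 0`. -/
noncomputable def lyapunov (f : EuclideanSpace ℝ (Fin n) → ℝ) (lam p : ℝ) (b : ℕ → Fin m)
    (Lk : ℕ → ℝ) (x : ℕ → EuclideanSpace ℝ (Fin n)) (ε : ℕ → Fin n → ℝ) (k : ℕ) : ℝ :=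
  objective f lam p (x k) (ε k) + 1 / 4 * ∑ i, Lk (lastUpdate b i k) *
    ‖x (lastUpdate b i k) - x (lastUpdate b i k - 1)‖ ^ 2

lemma lyapunov_decrease (hδ : δ < 1) (hprob : ProblemAssumption blk f lam p ℓ L)
    (hμ : μ ∈ Set.Ioo (0 : ℝ) 1) (hgen : IsGenerated blk f lam p ℓ L δ μ b Lk β x ε)
    (hcyc : EssentiallyCyclic b T) (k : ℕ) :
    (1 - δ) / 4 * ℓ * ‖x (k + 1) - x k‖ ^ 2 ≤
      lyapunov f lam p b Lk x ε k - lyapunov f lam p b Lk x ε (k + 1) := by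
  have h1 := objective_decrease hprob hμ hgen k
  have h2 := extrapolation_error_le hprob.ell_pos hgen hcyc k (norm_nonneg (x (k + 1) - x k))
  have hL := (hgen.lip_mem (k + 1) (by omega)).1
  set q : ℕ → ℝ := fun κ => Lk κ * ‖x κ - x (κ - 1)‖ ^ 2 with hq
  have hq0 : ∀ κ, 0 ≤ q κ := by
    intro κ
    rcases Nat.eq_zero_or_pos κ with h | h
    · simp [hq, h]
    · have := (hgen.lip_mem κ h).1
      have := hprob.ell_pos
      exact mul_nonneg (by linarith) (sq_nonneg _)
  -- only the summand of the updated block changes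
  have h3 : ∑ i, q (lastUpdate b i (k + 1)) =
      ∑ i, q (lastUpdate b i k) + (q (k + 1) - q (lastUpdate b (b (k + 1)) k)) := by
    rw [← sub_eq_iff_eq_add', ← Finset.sum_sub_distrib]
    have : ∀ i, q (lastUpdate b i (k + 1)) - q (lastUpdate b i k) =
        if b (k + 1) = i then q (k + 1) - q (lastUpdate b i k) else 0 := by
      intro i
      rw [lastUpdate_succ]
      split_ifs <;> simp
    simp [this]
  have h4 : q (k + 1) = Lk (k + 1) * ‖x (k + 1) - x k‖ ^ 2 := rfl
  change _ ≤ objective f lam p (x k) (ε k) + 1 / 4 * ∑ i, q (lastUpdate b i k) -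
    (objective f lam p (x (k + 1)) (ε (k + 1)) + 1 / 4 * ∑ i, q (lastUpdate b i (k + 1)))
  change _ ≤ δ / 4 * (_ + q _) at h2
  rw [h3, h4]
  rw [← h4] at h2 ⊢
  have h5 := hq0 (lastUpdate b (b (k + 1)) k)
  have h6 : (1 - δ) / 4 * ℓ * ‖x (k + 1) - x k‖ ^ 2 ≤ (1 - δ) / 4 * q (k + 1) := by
    rw [mul_assoc, h4]
    have : 0 ≤ (1 - δ) / 4 := by linarith
    gcongr
  have h7 : 0 ≤ (1 - δ) / 4 * q (lastUpdate b (b (k + 1)) k) := mul_nonneg (by linarith) h5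
  have h8 : Lk (k + 1) / 2 * ‖x (k + 1) - x k‖ ^ 2 = q (k + 1) / 2 := by rw [h4]; ring
  rw [h8] at h1
  linarith

end Generated

/-! ### Lengths of windows of steps -/

/-- The length of the `s`-th step, enlarged by a geometric term that dominates the smoothing
parameters. -/
noncomputable def stepLen {X : Type*} [Dist X] (x : ℕ → X) (ν : ℝ) (s : ℕ) : ℝ :=
  dist (x s) (x (s + 1)) + ν ^ s

/-- The sum of `stepLen` over the last `N` steps before `k`. -/
noncomputable def windowLen {X : Type*} [Dist X] (x : ℕ → X) (ν : ℝ) (N k : ℕ) : ℝ :=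
  ∑ s ∈ Finset.Ico (k - N) k, stepLen x ν s

section Window

variable {X : Type*} [PseudoMetricSpace X] {x : ℕ → X} {ν : ℝ} {N k : ℕ}

lemma stepLen_nonneg (hν : 0 ≤ ν) (s : ℕ) : 0 ≤ stepLen x ν s :=
  add_nonneg dist_nonneg (pow_nonneg hν _)

lemma windowLen_nonneg (hν : 0 ≤ ν) : 0 ≤ windowLen x ν N k :=
  Finset.sum_nonneg fun s _ => stepLen_nonneg hν s

lemma stepLen_le_windowLen (hν : 0 ≤ ν) {s : ℕ} (h1 : k ≤ s + N) (h2 : s < k) :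
    stepLen x ν s ≤ windowLen x ν N k :=
  Finset.single_le_sum (f := stepLen x ν) (fun s _ => stepLen_nonneg hν s)
    (Finset.mem_Ico.2 ⟨by omega, h2⟩)

lemma dist_succ_le_windowLen (hν : 0 ≤ ν) {s : ℕ} (h1 : k ≤ s + N) (h2 : s < k) :
    dist (x s) (x (s + 1)) ≤ windowLen x ν N k :=
  (le_add_of_nonneg_right (pow_nonneg hν s)).trans (stepLen_le_windowLen hν h1 h2)

lemma pow_le_windowLen (hν : 0 ≤ ν) {s : ℕ} (h1 : k ≤ s + N) (h2 : s < k) :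
    ν ^ s ≤ windowLen x ν N k :=
  (le_add_of_nonneg_left dist_nonneg).trans (stepLen_le_windowLen hν h1 h2)

lemma dist_le_windowLen (hν : 0 ≤ ν) {s : ℕ} (h1 : k ≤ s + N) (h2 : s ≤ k) :
    dist (x s) (x k) ≤ windowLen x ν N k :=
  calc dist (x s) (x k) ≤ ∑ i ∈ Finset.Ico s k, dist (x i) (x (i + 1)) := dist_le_Ico_sum_dist x h2
    _ ≤ ∑ i ∈ Finset.Ico s k, stepLen x ν i :=
      Finset.sum_le_sum fun i _ => le_add_of_nonneg_right (pow_nonneg hν i)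
    _ ≤ _ := Finset.sum_le_sum_of_subset_of_nonneg
      (Finset.Ico_subset_Ico (by omega) le_rfl) fun i _ _ => stepLen_nonneg hν i

lemma tendsto_windowLen (hν0 : 0 ≤ ν) (hν1 : ν < 1)
    (h : Tendsto (fun s => dist (x s) (x (s + 1))) atTop (𝓝 0)) (N : ℕ) :
    Tendsto (windowLen x ν N) atTop (𝓝 0) := by
  have h1 : Tendsto (stepLen x ν) atTop (𝓝 0) := by
    have := h.add (tendsto_pow_atTop_nhds_zero_of_lt_one hν0 hν1)
    rwa [add_zero] at this
  have h2 : Tendsto (fun k => ∑ i ∈ Finset.range N, stepLen x ν (k - N + i)) atTop (𝓝 0) := by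
    rw [← Finset.sum_const_zero (s := Finset.range N)]
    refine tendsto_finsetSum _ fun i _ => h1.comp ?_
    exact tendsto_atTop_mono (fun k => Nat.le_add_right _ i) (tendsto_sub_atTop_nat N)
  refine h2.congr' ?_
  filter_upwards [eventually_ge_atTop N] with k hk
  rw [windowLen, Finset.sum_Ico_eq_sum_range]
  congr 2
  omega

end Window

/-! ### Boundedness, vanishing steps and identification of the support -/

lemma continuous_gradient {E : Type*} [NormedAddCommGroup E] [InnerProductSpace ℝ E]
    [CompleteSpace E] {f : E → ℝ} (hf : ContDiff ℝ 1 f) : Continuous (gradient f) :=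
  (InnerProductSpace.toDual ℝ E).symm.continuous.comp (hf.continuous_fderiv one_ne_zero)

section Generated

variable {n m : ℕ} {blk : Fin n → Fin m} {f : EuclideanSpace ℝ (Fin n) → ℝ}
  {lam p ℓ L δ μ : ℝ} {T : ℕ} {b : ℕ → Fin m} {Lk β : ℕ → ℝ}
  {x : ℕ → EuclideanSpace ℝ (Fin n)} {ε : ℕ → Fin n → ℝ}

lemma tendsto_lastUpdate (hcyc : EssentiallyCyclic b T) (i : Fin m) :
    Tendsto (lastUpdate b i) atTop atTop :=
  tendsto_atTop_mono (fun k => Nat.sub_le_of_le_add (le_lastUpdate_add hcyc i k))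
    (tendsto_sub_atTop_nat T)

lemma objective_zero_le (hprob : ProblemAssumption blk f lam p ℓ L)
    (z : EuclideanSpace ℝ (Fin n)) (e : Fin n → ℝ) :
    objective f lam p z 0 ≤ objective f lam p z e := by
  have := hprob.p_pos
  have hj : ∀ j, (|z j| + (0 : Fin n → ℝ) j ^ 2) ^ p ≤ (|z j| + e j ^ 2) ^ p := fun j => by
    refine Real.rpow_le_rpow (by positivity) ?_ (by positivity)
    simpa using sq_nonneg (e j)
  exact add_le_add_right (mul_le_mul_of_nonneg_left (Finset.sum_le_sum fun j _ => hj j)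
    hprob.lam_pos.le) _

lemma exists_norm_le (hprob : ProblemAssumption blk f lam p ℓ L)
    (hdesc : ∀ k, objective f lam p (x (k + 1)) (ε (k + 1)) ≤ objective f lam p (x k) (ε k)) :
    ∃ R : ℝ, 0 < R ∧ ∀ k, ‖x k‖ ≤ R := by
  have hanti : Antitone fun k => objective f lam p (x k) (ε k) := antitone_nat_of_succ_le hdesc
  have h := hprob.coercive.eventually_gt_atTop (objective f lam p (x 0) (ε 0))
  have h2 : Bornology.IsBounded {z | ¬ objective f lam p (x 0) (ε 0) < objective f lam p z 0} :=
    Bornology.isBounded_def.2 (by simp only [Set.compl_ofPred, not_not]; exact h)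
  obtain ⟨R, hR, hsub⟩ := h2.exists_pos_norm_le
  refine ⟨R, hR, fun k => hsub _ ?_⟩
  exact not_lt.2 ((objective_zero_le hprob (x k) (ε k)).trans (hanti (Nat.zero_le k)))

lemma step_energy_nonneg (hℓ : 0 < ℓ) (hgen : IsGenerated blk f lam p ℓ L δ μ b Lk β x ε) (κ : ℕ) :
    0 ≤ Lk κ * ‖x κ - x (κ - 1)‖ ^ 2 := by
  rcases Nat.eq_zero_or_pos κ with h | h
  · simp [h]
  · have := (hgen.lip_mem κ h).1
    exact mul_nonneg (by linarith) (sq_nonneg _)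

/-- The Lyapunov function converges, since `f` is bounded below on the bounded set of iterates. -/
lemma exists_tendsto_lyapunov (hδ : δ < 1) (hprob : ProblemAssumption blk f lam p ℓ L)
    (hμ : μ ∈ Set.Ioo (0 : ℝ) 1) (hgen : IsGenerated blk f lam p ℓ L δ μ b Lk β x ε)
    (hcyc : EssentiallyCyclic b T)
    (hdesc : ∀ k, objective f lam p (x (k + 1)) (ε (k + 1)) ≤ objective f lam p (x k) (ε k)) :
    ∃ F : ℝ, Tendsto (lyapunov f lam p b Lk x ε) atTop (𝓝 F) ∧
      ∀ k, F ≤ lyapunov f lam p b Lk x ε k := by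
  obtain ⟨R, hR, hx⟩ := exists_norm_le hprob hdesc
  have hanti : Antitone (lyapunov f lam p b Lk x ε) := antitone_nat_of_succ_le fun k => by
    have h1 := lyapunov_decrease hδ hprob hμ hgen hcyc k
    have h2 : 0 ≤ (1 - δ) / 4 * ℓ * ‖x (k + 1) - x k‖ ^ 2 :=
      mul_nonneg (mul_nonneg (by linarith) hprob.ell_pos.le) (sq_nonneg _)
    linarith
  obtain ⟨a, ha⟩ := ((isCompact_closedBall (0 : EuclideanSpace ℝ (Fin n)) R).image_of_continuousOn
    hprob.contDiff.continuous.continuousOn).bddBelow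
  have hbdd : BddBelow (Set.range (lyapunov f lam p b Lk x ε)) := by
    refine ⟨a, ?_⟩
    rintro _ ⟨k, rfl⟩
    have h1 : a ≤ f (x k) := ha ⟨x k, by simpa using hx k, rfl⟩
    have h2 : 0 ≤ lam * ∑ j, (|x k j| + ε k j ^ 2) ^ p :=
      mul_nonneg hprob.lam_pos.le (Finset.sum_nonneg fun j _ => by positivity)
    have h3 : 0 ≤ ∑ i, Lk (lastUpdate b i k) *
        ‖x (lastUpdate b i k) - x (lastUpdate b i k - 1)‖ ^ 2 :=
      Finset.sum_nonneg fun i _ => step_energy_nonneg hprob.ell_pos hgen _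
    simp only [lyapunov, objective]
    linarith
  exact ⟨_, tendsto_atTop_ciInf hanti hbdd, fun k => ciInf_le hbdd k⟩

lemma tendsto_dist_succ (hδ : δ < 1) (hprob : ProblemAssumption blk f lam p ℓ L)
    (hμ : μ ∈ Set.Ioo (0 : ℝ) 1) (hgen : IsGenerated blk f lam p ℓ L δ μ b Lk β x ε)
    (hcyc : EssentiallyCyclic b T)
    (hdesc : ∀ k, objective f lam p (x (k + 1)) (ε (k + 1)) ≤ objective f lam p (x k) (ε k)) :
    Tendsto (fun k => dist (x k) (x (k + 1))) atTop (𝓝 0) := by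
  obtain ⟨F, hF, -⟩ := exists_tendsto_lyapunov hδ hprob hμ hgen hcyc hdesc
  have h1 : Tendsto (fun k => (lyapunov f lam p b Lk x ε k - lyapunov f lam p b Lk x ε (k + 1)) /
      ((1 - δ) / 4 * ℓ)) atTop (𝓝 0) := by
    have := (hF.sub (hF.comp (tendsto_add_atTop_nat 1))).div_const ((1 - δ) / 4 * ℓ)
    simpa using this
  have hc : 0 < (1 - δ) / 4 * ℓ := mul_pos (by linarith) hprob.ell_pos
  have h2 : Tendsto (fun k => dist (x k) (x (k + 1)) ^ 2) atTop (𝓝 0) := by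
    refine squeeze_zero (fun k => sq_nonneg _) (fun k => ?_) h1
    rw [le_div_iff₀ hc, dist_comm, dist_eq_norm]
    have := lyapunov_decrease hδ hprob hμ hgen hcyc k
    linarith
  have h3 := (Real.continuous_sqrt.tendsto 0).comp h2
  simpa [Function.comp_def, Real.sqrt_sq dist_nonneg] using h3

lemma norm_lastUpdate_sub_le (hcyc : EssentiallyCyclic b T) {ν : ℝ} (hν : 0 ≤ ν) {N : ℕ}
    (hN : T ≤ N) (i : Fin m) {k : ℕ} (hk : T ≤ k) :
    ‖x (lastUpdate b i k) - x (lastUpdate b i k - 1)‖ ≤ windowLen x ν N k := by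
  have h1 := lt_lastUpdate_add hcyc i hk
  have h2 : lastUpdate b i k ≤ k := lastUpdate_le
  have h3 : lastUpdate b i k - 1 + 1 = lastUpdate b i k := by omega
  have := dist_succ_le_windowLen (x := x) (ν := ν) (N := N) (k := k) hν
    (s := lastUpdate b i k - 1) (by omega) (by omega)
  rwa [h3, dist_comm, dist_eq_norm] at this

lemma step_energy_sum_le (hprob : ProblemAssumption blk f lam p ℓ L)
    (hgen : IsGenerated blk f lam p ℓ L δ μ b Lk β x ε)
    (hcyc : EssentiallyCyclic b T) {ν : ℝ} (hν : 0 ≤ ν) {N : ℕ} (hN : T ≤ N) {k : ℕ} (hk : T ≤ k) :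
    ∑ i, Lk (lastUpdate b i k) * ‖x (lastUpdate b i k) - x (lastUpdate b i k - 1)‖ ^ 2 ≤
      m * L * windowLen x ν N k ^ 2 := by
  calc _ ≤ ∑ _i : Fin m, L * windowLen x ν N k ^ 2 := by
        refine Finset.sum_le_sum fun i _ => ?_
        have h1 := lt_lastUpdate_add hcyc i hk
        have h2 := hgen.lip_mem (lastUpdate b i k) (by omega)
        have h3 := hprob.ell_pos
        have h4 := norm_lastUpdate_sub_le (x := x) hcyc hν hN i hk
        exact mul_le_mul h2.2 (pow_le_pow_left₀ (norm_nonneg _) h4 2) (sq_nonneg _) (by linarith)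
    _ = _ := by simp; ring

lemma sqrt_mu_mem (hμ : μ ∈ Set.Ioo (0 : ℝ) 1) : 0 < √μ ∧ √μ < 1 :=
  ⟨Real.sqrt_pos.2 hμ.1, by
    rw [Real.sqrt_lt' one_pos]; simpa using hμ.2⟩

/-- First-order optimality of the subproblem in a coordinate that is nonzero after the update. -/
lemma stationarity (hprob : ProblemAssumption blk f lam p ℓ L)
    (hgen : IsGenerated blk f lam p ℓ L δ μ b Lk β x ε) {k : ℕ} {j : Fin n}
    (hj : blk j = b (k + 1)) (hx : x (k + 1) j ≠ 0) :
    gradient f (extrapolated blk b β x (k + 1)) j +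
      2 * Lk (k + 1) * (x (k + 1) j - extrapolated blk b β x (k + 1) j) +
      weight lam p (x k) (ε k) j * (SignType.sign (x (k + 1) j) : ℝ) = 0 := by
  set y := extrapolated blk b β x (k + 1) with hy
  set g := gradient f y with hg
  set w := weight lam p (x k) (ε k) with hw
  have hL : 0 < Lk (k + 1) := by
    have := (hgen.lip_mem (k + 1) (by omega)).1; have := hprob.ell_pos; linarith
  have hcoef : 1 / (2 * (1 / (2 * Lk (k + 1)))) = Lk (k + 1) := by field_simp
  -- moving the `j`-th coordinate alone by `t` does not decrease the subproblem
  have hmin : ∀ t : ℝ, 0 ≤ g j * t + Lk (k + 1) * (2 * t * (x (k + 1) j - y j) + t ^ 2) +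
      w j * (|x (k + 1) j + t| - |x (k + 1) j|) := by
    intro t
    have h := hgen.step_min (k + 1) (by omega) (x (k + 1) + EuclideanSpace.single j t)
    simp only [subproblem, Nat.add_sub_cancel] at h
    rw [hcoef, ← hw, ← hy, ← hg] at h
    have hs : blockPart blk (b (k + 1)) (EuclideanSpace.single j t) =
        EuclideanSpace.single j t := by
      ext i
      rw [blockPart_apply]
      by_cases hij : i = j
      · simp [hij, hj]
      · simp [hij]
    have hadd : ∀ u v : EuclideanSpace ℝ (Fin n), blockPart blk (b (k + 1)) (u + v) =
        blockPart blk (b (k + 1)) u + blockPart blk (b (k + 1)) v := by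
      intro u v
      ext i
      simp only [blockPart_apply, PiLp.add_apply]
      split_ifs <;> simp
    have h1 : inner ℝ (blockPart blk (b (k + 1)) g)
        (blockPart blk (b (k + 1)) (x (k + 1) + EuclideanSpace.single j t)) =
        inner ℝ (blockPart blk (b (k + 1)) g) (blockPart blk (b (k + 1)) (x (k + 1))) +
          g j * t := by
      rw [hadd, hs, inner_add_right]
      congr 1
      simp [EuclideanSpace.inner_single_right, blockPart_apply, hj, mul_comm]
    have h2 : ‖blockPart blk (b (k + 1)) (x (k + 1) + EuclideanSpace.single j t - y)‖ ^ 2 =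
        ‖blockPart blk (b (k + 1)) (x (k + 1) - y)‖ ^ 2 +
          (2 * t * (x (k + 1) j - y j) + t ^ 2) := by
      rw [add_sub_right_comm, hadd, hs, norm_add_sq_real]
      simp [EuclideanSpace.inner_single_right, blockPart_apply, hj]
      ring
    have h3 : ∑ i with blk i = b (k + 1), w i * |(x (k + 1) + EuclideanSpace.single j t) i| =
        ∑ i with blk i = b (k + 1), w i * |x (k + 1) i| +
          w j * (|x (k + 1) j + t| - |x (k + 1) j|) := by
      rw [← sub_eq_iff_eq_add', ← Finset.sum_sub_distrib, Finset.sum_eq_single j]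
      · simp; ring
      · intro i _ hij
        simp [hij]
      · intro h; simp [hj] at h
    rw [h1, h2, h3] at h
    linarith
  have hder : HasDerivAt (fun t : ℝ => g j * t +
      Lk (k + 1) * (2 * t * (x (k + 1) j - y j) + t ^ 2) +
        w j * (|x (k + 1) j + t| - |x (k + 1) j|))
      (g j + 2 * Lk (k + 1) * (x (k + 1) j - y j) +
        w j * (SignType.sign (x (k + 1) j) : ℝ)) 0 := by
    have h1 : HasDerivAt (fun t : ℝ => |x (k + 1) j + t|) (SignType.sign (x (k + 1) j) : ℝ) 0 := by
      have := (hasDerivAt_abs (x := x (k + 1) j + 0) (by simpa using hx)).comp 0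
        ((hasDerivAt_id (0 : ℝ)).const_add (x (k + 1) j))
      simpa [Function.comp_def] using this
    have h2 := (((hasDerivAt_id (0 : ℝ)).const_mul (g j)).add
      (((((hasDerivAt_id (0 : ℝ)).const_mul 2).mul_const (x (k + 1) j - y j)).add
        (hasDerivAt_pow 2 (0 : ℝ))).const_mul (Lk (k + 1)))).add
        ((h1.sub_const (|x (k + 1) j|)).const_mul (w j))
    refine h2.congr_deriv ?_
    simp; ring
  refine IsLocalMin.hasDerivAt_eq_zero (Filter.Eventually.of_forall fun t => ?_) hder
  simpa using hmin t

/-- The weight of a coordinate that stays nonzero in an update is bounded, hence the smoothed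
modulus of the coordinate before the update is bounded away from `0`. -/
lemma exists_lower_bound (hprob : ProblemAssumption blk f lam p ℓ L)
    (hgen : IsGenerated blk f lam p ℓ L δ μ b Lk β x ε)
    (hdesc : ∀ k, objective f lam p (x (k + 1)) (ε (k + 1)) ≤ objective f lam p (x k) (ε k)) :
    ∃ η : ℝ, 0 < η ∧ ∀ k j, blk j = b (k + 1) → x (k + 1) j ≠ 0 →
      η ≤ |x k j| + ε k j ^ 2 := by
  obtain ⟨R, hR, hxR⟩ := exists_norm_le hprob hdesc
  obtain ⟨G, hG⟩ := (isCompact_closedBall (0 : EuclideanSpace ℝ (Fin n))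
    (3 * R)).exists_bound_of_continuousOn (continuous_gradient hprob.contDiff).continuousOn
  have hlp : 0 < lam * p := mul_pos hprob.lam_pos hprob.p_pos
  -- `H` bounds the weight: `G` bounds the gradient at the extrapolated points, and those are within
  -- `4 * R` of the iterates
  set H := |G| + 2 * |L| * (4 * R) + 1 with hH
  have hHpos : 0 < H := by positivity
  refine ⟨(H / (lam * p)) ^ (p - 1)⁻¹, by positivity, fun k j hj hx => ?_⟩
  have hst := stationarity hprob hgen hj hx
  have he := eps_pos hgen k j
  set y := extrapolated blk b β x (k + 1) with hy
  have hyx : ‖y - x k‖ ≤ 2 * R := by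
    have hβ := hgen.beta_mem (k + 1) (by omega)
    have h2 : ∀ κ, ‖x κ - x (κ - 1)‖ ≤ 2 * R := fun κ =>
      (norm_sub_le _ _).trans (by linarith [hxR κ, hxR (κ - 1)])
    refine (norm_extrapolated_sub_le hgen k).trans ?_
    exact (mul_le_of_le_one_left (norm_nonneg _) hβ.2).trans (h2 _)
  have hyR : ‖y‖ ≤ 3 * R := by
    have := norm_le_norm_add_norm_sub (x k) y
    rw [norm_sub_rev] at this
    linarith [hxR k]
  have h1 : |gradient f y j| ≤ |G| :=
    ((abs_apply_le_norm _ _).trans (hG y (by simpa using hyR))).trans (le_abs_self G)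
  have h2 : |x (k + 1) j - y j| ≤ 4 * R := by
    have h3 := abs_apply_le_norm (x (k + 1) - y) j
    have h4 := norm_sub_le (x (k + 1)) y
    simp only [PiLp.sub_apply] at h3
    linarith [hxR (k + 1)]
  have hL := hgen.lip_mem (k + 1) (by omega)
  have hL0 : 0 < Lk (k + 1) := by have := hprob.ell_pos; linarith
  have h3 : |2 * Lk (k + 1) * (x (k + 1) j - y j)| ≤ 2 * |L| * (4 * R) := by
    rw [abs_mul, abs_of_pos (by positivity : 0 < 2 * Lk (k + 1))]
    have := hL.2.trans (le_abs_self L)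
    gcongr
  have hsign : |(SignType.sign (x (k + 1) j) : ℝ)| = 1 := by
    rcases lt_or_gt_of_ne hx with h | h <;> simp [h]
  have hw0 : 0 < weight lam p (x k) (ε k) j := by
    rw [weight]; positivity
  have hw : weight lam p (x k) (ε k) j ≤ H := by
    have h4 : weight lam p (x k) (ε k) j =
        |gradient f y j + 2 * Lk (k + 1) * (x (k + 1) j - y j)| := by
      rw [eq_neg_of_add_eq_zero_left hst, abs_neg, abs_mul, hsign, mul_one, abs_of_pos hw0]
    rw [h4]
    have := abs_add_le (gradient f y j) (2 * Lk (k + 1) * (x (k + 1) j - y j))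
    linarith
  rw [Real.rpow_inv_le_iff_of_neg (by positivity) (by positivity)
    (by linarith [hprob.p_lt_one]), le_div_iff₀ hlp, mul_comm]
  exact hw

lemma mem_limitSupport {j : Fin n} : j ∈ limitSupport x ↔ ∀ᶠ k in atTop, x k j ≠ 0 := by
  simp [limitSupport]

lemma tendsto_eps_zero (hμ : μ ∈ Set.Ioo (0 : ℝ) 1)
    (hgen : IsGenerated blk f lam p ℓ L δ μ b Lk β x ε) {j : Fin n}
    (hj : ∃ᶠ k in atTop, x k j ≠ 0) : Tendsto (fun k => ε k j) atTop (𝓝 0) := by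
  have hbdd : BddBelow (Set.range fun k => ε k j) :=
    ⟨0, by rintro _ ⟨k, rfl⟩; exact (eps_pos hgen k j).le⟩
  have h := tendsto_atTop_ciInf (eps_antitone hμ hgen j) hbdd
  set l := ⨅ k, ε k j
  have hl : 0 ≤ l := ge_of_tendsto' h fun k => (eps_pos hgen k j).le
  have h1 : ∃ᶠ k in atTop, ε (k + 1) j - √μ * ε k j ≤ 0 := by
    have h2 : ∃ᶠ k in atTop, x (k + 1) j ≠ 0 := by
      rw [frequently_atTop] at hj ⊢
      intro a
      obtain ⟨k, hk, hkx⟩ := hj (a + 1)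
      exact ⟨k - 1, by omega, by rwa [Nat.sub_add_cancel (by omega)]⟩
    exact h2.mono fun k hk => sub_nonpos.2 (hgen.eps_nonzero k j hk).2
  have h2 : l - √μ * l ≤ 0 := le_of_tendsto_of_frequently
    ((h.comp (tendsto_add_atTop_nat 1)).sub (h.const_mul _)) h1
  have h3 := (sqrt_mu_mem hμ).2
  have : l = 0 := by nlinarith
  rwa [this] at h

/-- A coordinate outside the limit support vanishes from some iteration on: once the coordinate is
zero while its smoothing parameter is small, the large weight keeps it at zero. -/
lemma eventually_eq_zero (hprob : ProblemAssumption blk f lam p ℓ L) (hμ : μ ∈ Set.Ioo (0 : ℝ) 1)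
    (hgen : IsGenerated blk f lam p ℓ L δ μ b Lk β x ε)
    (hdesc : ∀ k, objective f lam p (x (k + 1)) (ε (k + 1)) ≤ objective f lam p (x k) (ε k))
    {j : Fin n} (hj : j ∉ limitSupport x) : ∀ᶠ k in atTop, x k j = 0 := by
  obtain ⟨η, hη, hlow⟩ := exists_lower_bound hprob hgen hdesc
  by_contra hne
  rw [mem_limitSupport] at hj
  have hz : ∃ᶠ k in atTop, x k j = 0 := by simpa [Filter.Frequently] using hj
  have hε : Tendsto (fun k => ε k j ^ 2) atTop (𝓝 0) := by
    simpa using (tendsto_eps_zero hμ hgen (by simpa [Filter.Frequently] using hne)).pow 2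
  obtain ⟨K, hK⟩ := eventually_atTop.1 (hε.eventually_lt_const hη)
  obtain ⟨k, hkz, hkK⟩ := (hz.and_eventually (eventually_ge_atTop K)).exists
  refine hne (eventually_atTop.2 ⟨k, fun l hl => ?_⟩)
  induction l, hl using Nat.le_induction with
  | base => exact hkz
  | succ l hl ih =>
    by_contra hx
    by_cases hb : blk j = b (l + 1)
    · have h1 := hlow l j hb hx
      rw [ih, abs_zero, zero_add] at h1
      exact absurd (hK l (by omega)) (not_lt.2 h1)
    · exact hx ((hgen.step_off (l + 1) (by omega) j hb).trans ih)

lemma eventually_apply_eq_zero (hprob : ProblemAssumption blk f lam p ℓ L)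
    (hμ : μ ∈ Set.Ioo (0 : ℝ) 1) (hgen : IsGenerated blk f lam p ℓ L δ μ b Lk β x ε)
    (hdesc : ∀ k, objective f lam p (x (k + 1)) (ε (k + 1)) ≤ objective f lam p (x k) (ε k)) :
    ∀ᶠ k in atTop, ∀ j, j ∉ limitSupport x → x k j = 0 := by
  rw [eventually_all]
  intro j
  by_cases hj : j ∈ limitSupport x
  · simp [hj]
  · filter_upwards [eventually_eq_zero hprob hμ hgen hdesc hj] with k hk _ using hk

lemma exists_eps_le_pow (hμ : μ ∈ Set.Ioo (0 : ℝ) 1)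
    (hgen : IsGenerated blk f lam p ℓ L δ μ b Lk β x ε) :
    ∃ C : ℝ, 0 < C ∧ ∀ j ∈ limitSupport x, ∀ k, ε k j ≤ C * √μ ^ k := by
  obtain ⟨hν0, hν1⟩ := sqrt_mu_mem hμ
  have h : ∀ j ∈ limitSupport x, ∃ C : ℝ, 0 < C ∧ ∀ k, ε k j ≤ C * √μ ^ k := by
    intro j hj
    obtain ⟨K, hK⟩ := eventually_atTop.1 (mem_limitSupport.1 hj)
    have hC : 0 < ε 0 j / √μ ^ K := div_pos (hgen.eps_init j) (by positivity)
    refine ⟨ε 0 j / √μ ^ K, hC, fun k => ?_⟩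
    have hsmall : ∀ k ≤ K, ε k j ≤ ε 0 j / √μ ^ K * √μ ^ k := fun k hk => by
      rw [div_mul_eq_mul_div, le_div_iff₀ (by positivity)]
      exact mul_le_mul (eps_antitone hμ hgen j (Nat.zero_le k))
        (pow_le_pow_of_le_one hν0.le hν1.le hk) (by positivity) (hgen.eps_init j).le
    induction k with
    | zero => exact hsmall 0 (Nat.zero_le _)
    | succ k ih =>
      rcases le_or_gt (k + 1) K with hk | hk
      · exact hsmall _ hk
      · calc ε (k + 1) j ≤ √μ * ε k j := (hgen.eps_nonzero k j (hK _ hk.le)).2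
          _ ≤ √μ * (ε 0 j / √μ ^ K * √μ ^ k) := by gcongr
          _ = _ := by ring
  choose! C hC0 hC using h
  refine ⟨∑ j ∈ limitSupport x, C j + 1,
    add_pos_of_nonneg_of_pos (Finset.sum_nonneg fun j hj => (hC0 j hj).le) one_pos,
    fun j hj k => (hC j hj k).trans ?_⟩
  gcongr
  have := Finset.single_le_sum (fun j hj => (hC0 j hj).le) hj
  linarith

/-- The coordinates in the limit support stay away from `0`. -/
lemma exists_le_abs (hδ : δ < 1) (hprob : ProblemAssumption blk f lam p ℓ L)
    (hμ : μ ∈ Set.Ioo (0 : ℝ) 1) (hgen : IsGenerated blk f lam p ℓ L δ μ b Lk β x ε)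
    (hcyc : EssentiallyCyclic b T)
    (hdesc : ∀ k, objective f lam p (x (k + 1)) (ε (k + 1)) ≤ objective f lam p (x k) (ε k)) :
    ∃ η : ℝ, 0 < η ∧ ∀ᶠ k in atTop, ∀ j ∈ limitSupport x, η ≤ |x k j| := by
  obtain ⟨η, hη, hlow⟩ := exists_lower_bound hprob hgen hdesc
  -- before the last update the modulus is at least `η / 2`, as `ε ^ 2 < η / 2`, and the update
  -- moves the coordinate by less than `η / 4`
  refine ⟨η / 4, by linarith, ?_⟩
  rw [Filter.eventually_all_finset]
  intro j hj
  have hxj := mem_limitSupport.1 hj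
  have hε : Tendsto (fun k => ε k j ^ 2) atTop (𝓝 0) := by
    simpa using (tendsto_eps_zero hμ hgen hxj.frequently).pow 2
  have hd := tendsto_dist_succ hδ hprob hμ hgen hcyc hdesc
  have hev : ∀ᶠ k in atTop, blk j = b (k + 1) → η / 4 ≤ |x (k + 1) j| := by
    filter_upwards [hε.eventually_lt_const (by linarith : 0 < η / 2),
      hd.eventually_lt_const (by linarith : 0 < η / 4),
      (tendsto_add_atTop_nat 1).eventually hxj] with k h1 h2 h3 h4
    have h5 := hlow k j h4 h3
    have h6 := abs_apply_le_norm (x k - x (k + 1)) j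
    rw [dist_eq_norm] at h2
    simp only [PiLp.sub_apply] at h6
    have h7 := abs_sub_abs_le_abs_sub (x k j) (x (k + 1) j)
    linarith
  have ht := (tendsto_sub_atTop_nat 1).comp (tendsto_lastUpdate hcyc (blk j))
  filter_upwards [ht.eventually hev,
    (tendsto_lastUpdate hcyc (blk j)).eventually (eventually_ge_atTop 1)] with k h1 h2
  simp only [Function.comp_apply, Nat.sub_add_cancel h2] at h1
  rw [← apply_lastUpdate hgen k j]
  exact h1 (lastUpdate_spec h2).symm

end Generated

/-! ### The Kurdyka–Łojasiewicz property -/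

section KL

variable {E : Type*} [NormedAddCommGroup E] [InnerProductSpace ℝ E]

lemma frechetSubdifferential_subset_limiting {J : E → ℝ} {z : E} :
    frechetSubdifferential J z ⊆ limitingSubdifferential J z := fun u hu =>
  ⟨fun _ => z, fun _ => u, tendsto_const_nhds, tendsto_const_nhds, fun _ => hu, tendsto_const_nhds⟩

lemma mem_frechetSubdifferential_of_hasFDerivAt {J : E → ℝ} {z u : E} {J' : E →L[ℝ] ℝ}
    (h : HasFDerivAt J J' z) (hu : ∀ v, J' v = inner ℝ u v) : u ∈ frechetSubdifferential J z := by
  intro η hη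
  filter_upwards [h.isLittleO.bound hη] with y hy
  rw [Real.norm_eq_abs, hu] at hy
  exact (abs_le.1 hy).1

/-- The Łojasiewicz inequality contained in the Kurdyka–Łojasiewicz property, for a single element
of the Fréchet subdifferential. -/
lemma HasKLProperty.exists_rpow_le {J : E → ℝ} {zbar : E} {c θ : ℝ}
    (hKL : HasKLProperty J zbar fun s : ℝ => c * s ^ (1 - θ)) (hJ : ContinuousAt J zbar) :
    ∃ r : ℝ, 0 < r ∧ ∀ z ∈ Metric.ball zbar r, J zbar < J z → ∀ u ∈ frechetSubdifferential J z,
      (J z - J zbar) ^ θ ≤ c * (1 - θ) * ‖u‖ := by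
  obtain ⟨-, U, hU, ξ, hξ, -, -, -, -, h⟩ := hKL
  obtain ⟨r, hr, hball⟩ := Metric.mem_nhds_iff.1
    (inter_mem hU (hJ.eventually_lt_const (by linarith : J zbar < J zbar + ξ)))
  refine ⟨r, hr, fun z hz hlt u hu => ?_⟩
  have h1 := h z (hball hz).1 hlt (hball hz).2
  set s := J z - J zbar with hs
  have hs0 : 0 < s := sub_pos.2 hlt
  have hd : deriv (fun s : ℝ => c * s ^ (1 - θ)) s = c * (1 - θ) * s ^ (-θ) := by
    have := ((Real.hasDerivAt_rpow_const (p := 1 - θ) (Or.inl hs0.ne')).const_mul c).deriv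
    rw [this, ← mul_assoc]
    congr 2
    ring
  have h2 : Metric.infEDist 0 (limitingSubdifferential J z) ≤ ENNReal.ofReal ‖u‖ := by
    refine (Metric.infEDist_le_edist_of_mem (frechetSubdifferential_subset_limiting hu)).trans ?_
    rw [edist_dist, dist_zero_left]
  have h3 : 1 ≤ ENNReal.ofReal (c * (1 - θ) * s ^ (-θ)) * ENNReal.ofReal ‖u‖ := by
    rw [← hd]
    exact h1.trans (by gcongr)
  rw [← ENNReal.ofReal_mul' (norm_nonneg u), ENNReal.one_le_ofReal, Real.rpow_neg hs0.le] at h3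
  have h4 : 0 < s ^ θ := Real.rpow_pos_of_pos hs0 θ
  calc s ^ θ = s ^ θ * 1 := (mul_one _).symm
    _ ≤ s ^ θ * (c * (1 - θ) * (s ^ θ)⁻¹ * ‖u‖) := by gcongr
    _ = _ := by field_simp

end KL

/-! ### The gradient of the reduced objective -/

section Reduced

variable {n : ℕ} {f : EuclideanSpace ℝ (Fin n) → ℝ} {lam p : ℝ} {I : Finset (Fin n)}

/-- The point `(x_I, e_I)` of `ℝ^{2|I|}`. -/
noncomputable def reducedPair (I : Finset (Fin n)) (x : EuclideanSpace ℝ (Fin n)) (e : Fin n → ℝ) :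
    EuclideanSpace ℝ (I ⊕ I) :=
  WithLp.toLp 2 (Sum.elim (fun i => x i) fun i => e i)

/-- The gradient of the reduced objective at points whose `x`-coordinates do not vanish. -/
noncomputable def reducedGradient (f : EuclideanSpace ℝ (Fin n) → ℝ) (lam p : ℝ)
    (I : Finset (Fin n)) (z : EuclideanSpace ℝ (I ⊕ I)) : EuclideanSpace ℝ (I ⊕ I) :=
  WithLp.toLp 2 (Sum.elim
    (fun i => gradient f (extendZero I fun i => z (Sum.inl i)) i +
      lam * p * (|z (Sum.inl i)| + z (Sum.inr i) ^ 2) ^ (p - 1) *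
        (SignType.sign (z (Sum.inl i)) : ℝ))
    fun i => lam * p * (|z (Sum.inl i)| + z (Sum.inr i) ^ 2) ^ (p - 1) * (2 * z (Sum.inr i)))

/-- `z ↦ (x_I, 0)` for `z = (x_I, ε_I)`, as a continuous linear map. -/
noncomputable def extendCLM (I : Finset (Fin n)) :
    EuclideanSpace ℝ (I ⊕ I) →L[ℝ] EuclideanSpace ℝ (Fin n) :=
  LinearMap.toContinuousLinearMap
    { toFun := fun z => extendZero I fun i => z (Sum.inl i)
      map_add' := fun z w => by
        ext j; simp only [extendZero, PiLp.add_apply]; split_ifs <;> simp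
      map_smul' := fun a z => by
        ext j; simp only [extendZero, PiLp.smul_apply]; split_ifs <;> simp }

lemma extendCLM_apply (z : EuclideanSpace ℝ (I ⊕ I)) :
    extendCLM I z = extendZero I fun i => z (Sum.inl i) := rfl

lemma inner_extendZero (g : EuclideanSpace ℝ (Fin n)) (v : I → ℝ) :
    inner ℝ g (extendZero I v) = ∑ i : I, g i * v i := by
  simp only [PiLp.inner_apply, extendZero]
  rw [← Finset.sum_subset (Finset.subset_univ I) (fun j _ hj => by simp [hj]),
    ← Finset.sum_coe_sort]
  refine Finset.sum_congr rfl fun i _ => ?_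
  simp [mul_comm]

lemma continuous_reducedObjective (hf : Continuous f) (hp : 0 < p) :
    Continuous (reducedObjective f lam p I) := by
  have h1 : Continuous fun z : EuclideanSpace ℝ (I ⊕ I) => extendZero I fun i => z (Sum.inl i) :=
    (extendCLM I).continuous
  unfold reducedObjective
  refine (hf.comp h1).add (continuous_const.mul (continuous_finsetSum _ fun i _ => ?_))
  refine Continuous.rpow_const ?_ fun _ => Or.inr hp.le
  fun_prop

lemma hasFDerivAt_penalty {z : EuclideanSpace ℝ (I ⊕ I)} {i : I} (hi : z (Sum.inl i) ≠ 0) :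
    HasFDerivAt (fun z : EuclideanSpace ℝ (I ⊕ I) => (|z (Sum.inl i)| + z (Sum.inr i) ^ 2) ^ p)
      ((p * (|z (Sum.inl i)| + z (Sum.inr i) ^ 2) ^ (p - 1)) •
        ((SignType.sign (z (Sum.inl i)) : ℝ) • EuclideanSpace.proj (𝕜 := ℝ) (Sum.inl i) +
          (2 * z (Sum.inr i)) • EuclideanSpace.proj (𝕜 := ℝ) (Sum.inr i))) z := by
  have h1 : HasFDerivAt (fun z : EuclideanSpace ℝ (I ⊕ I) => z (Sum.inl i))
      (EuclideanSpace.proj (𝕜 := ℝ) (Sum.inl i)) z := (EuclideanSpace.proj (𝕜 := ℝ) _).hasFDerivAt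
  have h2 : HasFDerivAt (fun z : EuclideanSpace ℝ (I ⊕ I) => z (Sum.inr i))
      (EuclideanSpace.proj (𝕜 := ℝ) (Sum.inr i)) z := (EuclideanSpace.proj (𝕜 := ℝ) _).hasFDerivAt
  have h3 := (hasDerivAt_abs hi).comp_hasFDerivAt z h1
  have h4 := (hasDerivAt_pow 2 (z (Sum.inr i))).comp_hasFDerivAt z h2
  have hpos : |z (Sum.inl i)| + z (Sum.inr i) ^ 2 ≠ 0 := by
    have := abs_pos.2 hi
    positivity
  have h5 := (h3.add h4).rpow_const (p := p) (Or.inl hpos)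
  refine h5.congr_fderiv ?_
  simp

lemma hasFDerivAt_comp_extendCLM (hf : Differentiable ℝ f) (z : EuclideanSpace ℝ (I ⊕ I)) :
    HasFDerivAt (fun z : EuclideanSpace ℝ (I ⊕ I) => f (extendCLM I z))
      ((innerSL ℝ (gradient f (extendCLM I z))).comp (extendCLM I)) z :=
  HasFDerivAt.comp (g := f) z (hf (extendCLM I z)).hasGradientAt.hasFDerivAt
    (extendCLM I).hasFDerivAt

lemma reducedGradient_mem (hf : Differentiable ℝ f) {z : EuclideanSpace ℝ (I ⊕ I)}
    (hz : ∀ i, z (Sum.inl i) ≠ 0) :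
    reducedGradient f lam p I z ∈ frechetSubdifferential (reducedObjective f lam p I) z := by
  have h1 := hasFDerivAt_comp_extendCLM hf z
  have h0 := fun i : I => hasFDerivAt_penalty (p := p) (hz i)
  have h2 := (HasFDerivAt.fun_sum (u := Finset.univ) fun i _ => h0 i).const_mul lam
  have h3 := h1.add h2
  refine mem_frechetSubdifferential_of_hasFDerivAt (J := reducedObjective f lam p I) h3 fun v => ?_
  have hproj : ∀ i : I ⊕ I, EuclideanSpace.proj (𝕜 := ℝ) i v = v i := fun _ => rfl
  rw [PiLp.inner_apply, Fintype.sum_sum_type]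
  simp only [add_apply, ContinuousLinearMap.comp_apply, innerSL_apply_apply,
    extendCLM_apply, inner_extendZero, smul_apply, sum_apply,
    smul_eq_mul, hproj]
  simp only [reducedGradient, Sum.elim_inl, Sum.elim_inr, RCLike.inner_apply, conj_trivial]
  rw [Finset.mul_sum, ← Finset.sum_add_distrib, ← Finset.sum_add_distrib]
  refine Finset.sum_congr rfl fun i _ => ?_
  ring

lemma abs_rpow_sub_le {η a b : ℝ} (hp1 : p < 1) (hη : 0 < η) (ha : η ≤ a) (hb : η ≤ b) :
    |a ^ (p - 1) - b ^ (p - 1)| ≤ (1 - p) * η ^ (p - 2) * |a - b| := by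
  refine Convex.norm_image_sub_le_of_norm_hasDerivWithin_le (s := Set.Ici η)
    (f := fun t => t ^ (p - 1)) (f' := fun t => (p - 1) * t ^ (p - 1 - 1)) (fun t ht => ?_)
    (fun t ht => ?_) (convex_Ici η) hb ha
  · exact (Real.hasDerivAt_rpow_const (Or.inl (hη.trans_le ht).ne')).hasDerivWithinAt
  · have ht0 : 0 < t := hη.trans_le ht
    rw [norm_mul, Real.norm_eq_abs, abs_of_neg (by linarith),
      Real.norm_of_nonneg (by positivity), neg_sub]
    have h2 : p - 1 - 1 = p - 2 := by ring
    rw [h2]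
    have : 0 ≤ 1 - p := by linarith
    gcongr ?_ * ?_
    exact Real.rpow_le_rpow_of_nonpos hη ht (by linarith)

end Reduced

section Generated

variable {n m : ℕ} {blk : Fin n → Fin m} {f : EuclideanSpace ℝ (Fin n) → ℝ}
  {lam p ℓ L δ μ : ℝ} {T : ℕ} {b : ℕ → Fin m} {Lk β : ℕ → ℝ}
  {x : ℕ → EuclideanSpace ℝ (Fin n)} {ε : ℕ → Fin n → ℝ}

/-- Comparison of the gradient of the reduced objective at `(x^k, e)` with the optimality conditions
of the last updates. The point `y` is the extrapolated point and `s + 1` the iteration of the last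
update of the block of `j`. -/
lemma abs_gradient_add_weight_le {xs : EuclideanSpace ℝ (Fin n)} {ρ LG η Cε W : ℝ} {k s : ℕ}
    {j : Fin n} {e : Fin n → ℝ} (hprob : ProblemAssumption blk f lam p ℓ L)
    (hgen : IsGenerated blk f lam p ℓ L δ μ b Lk β x ε)
    (hLG : ∀ i : Fin m, ∀ y ∈ Metric.ball xs (4 * ρ), ∀ z ∈ Metric.ball xs (4 * ρ),
      ‖blockPart blk i (gradient f y - gradient f z)‖ ≤ LG * ‖y - z‖)
    (hη : 0 < η) (hj : blk j = b (s + 1)) (hxj : x (s + 1) j = x k j)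
    (hk : η ≤ |x k j|) (hs : η ≤ |x s j|) (hW : 0 ≤ W) (hxW : ‖x k - x s‖ ≤ W)
    (hyW : ‖extrapolated blk b β x (s + 1) - x s‖ ≤ W) (hWρ : 2 * W < ρ)
    (hxk : dist (x k) xs < ρ) (he : |e j| ≤ ε s j) (hε : ε s j ^ 2 ≤ Cε * W) :
    |gradient f (x k) j + weight lam p (x k) e j * (SignType.sign (x k j) : ℝ)| ≤
      (2 * |LG| + 4 * |L| + lam * p * ((1 - p) * η ^ (p - 2) * (1 + Cε))) * W := by
  have hx0 : x (s + 1) j ≠ 0 := by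
    rw [hxj]; exact abs_pos.1 (hη.trans_le hk)
  have hst := stationarity hprob hgen hj hx0
  rw [hxj] at hst
  set y := extrapolated blk b β x (s + 1) with hy
  have hlp : 0 < lam * p := mul_pos hprob.lam_pos hprob.p_pos
  have hxy : ‖x k - y‖ ≤ 2 * W := by
    have h1 := norm_sub_le_norm_sub_add_norm_sub (x k) (x s) y
    rw [norm_sub_rev (x s) y] at h1
    linarith
  have h1 : |gradient f (x k) j - gradient f y j| ≤ 2 * |LG| * W := by
    have hxk4 : x k ∈ Metric.ball xs (4 * ρ) := by
      rw [Metric.mem_ball]; linarith [dist_nonneg (x := x k) (y := xs)]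
    have hy4 : y ∈ Metric.ball xs (4 * ρ) := by
      rw [Metric.mem_ball]
      have h2 := dist_triangle_left y xs (x k)
      rw [dist_eq_norm (x k) y] at h2
      linarith
    have h3 := hLG (blk j) (x k) hxk4 y hy4
    have h4 := abs_apply_le_norm (blockPart blk (blk j) (gradient f (x k) - gradient f y)) j
    simp only [blockPart_apply, if_true, PiLp.sub_apply] at h4
    calc _ ≤ LG * ‖x k - y‖ := h4.trans h3
      _ ≤ |LG| * (2 * W) := by gcongr; exact le_abs_self LG
      _ = _ := by ring
  have h2 : |2 * Lk (s + 1) * (x k j - y j)| ≤ 4 * |L| * W := by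
    have hL := hgen.lip_mem (s + 1) (by omega)
    have hL0 : 0 < Lk (s + 1) := by have := hprob.ell_pos; linarith
    have h3 := abs_apply_le_norm (x k - y) j
    simp only [PiLp.sub_apply] at h3
    rw [abs_mul, abs_of_pos (by positivity : 0 < 2 * Lk (s + 1))]
    calc 2 * Lk (s + 1) * |x k j - y j| ≤ 2 * |L| * (2 * W) := by
          have := hL.2.trans (le_abs_self L)
          have := h3.trans hxy
          gcongr
      _ = _ := by ring
  have h3 : |weight lam p (x k) e j - weight lam p (x s) (ε s) j| ≤
      lam * p * ((1 - p) * η ^ (p - 2) * (1 + Cε)) * W := by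
    rw [weight, weight, ← mul_sub, abs_mul, abs_of_pos hlp, mul_assoc (lam * p)]
    refine mul_le_mul_of_nonneg_left ?_ hlp.le
    refine (abs_rpow_sub_le hprob.p_lt_one hη (a := |x k j| + e j ^ 2) (b := |x s j| + ε s j ^ 2)
      (by nlinarith [sq_nonneg (e j)]) (by nlinarith [sq_nonneg (ε s j)])).trans ?_
    have h4 : |(|x k j| + e j ^ 2) - (|x s j| + ε s j ^ 2)| ≤ (1 + Cε) * W := by
      have h5 := abs_apply_le_norm (x k - x s) j
      simp only [PiLp.sub_apply] at h5
      have h6 : e j ^ 2 ≤ ε s j ^ 2 := sq_le_sq' (by linarith [neg_abs_le (e j)])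
        ((le_abs_self _).trans he)
      have h7 := abs_abs_sub_abs_le_abs_sub (x k j) (x s j)
      have h8 := abs_le.1 (h7.trans (h5.trans hxW))
      rw [abs_le]
      constructor <;> nlinarith [sq_nonneg (e j)]
    have h9 : 0 ≤ (1 - p) * η ^ (p - 2) :=
      mul_nonneg (by linarith [hprob.p_lt_one]) (by positivity)
    calc _ ≤ (1 - p) * η ^ (p - 2) * ((1 + Cε) * W) := by gcongr
      _ = _ := by ring
  have hsign : |(SignType.sign (x k j) : ℝ)| ≤ 1 := by
    rcases lt_trichotomy (x k j) 0 with h | h | h <;> simp [h]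
  -- subtract the optimality condition
  have h4 : gradient f (x k) j + weight lam p (x k) e j * (SignType.sign (x k j) : ℝ) =
      (gradient f (x k) j - gradient f y j) - 2 * Lk (s + 1) * (x k j - y j) +
      (weight lam p (x k) e j - weight lam p (x s) (ε s) j) * (SignType.sign (x k j) : ℝ) := by
    linarith
  have h5 : |(weight lam p (x k) e j - weight lam p (x s) (ε s) j) *
      (SignType.sign (x k j) : ℝ)| ≤ |weight lam p (x k) e j - weight lam p (x s) (ε s) j| := by
    rw [abs_mul]
    exact mul_le_of_le_one_right (abs_nonneg _) hsign
  rw [h4]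
  have h6 := abs_add_le ((gradient f (x k) j - gradient f y j) - 2 * Lk (s + 1) * (x k j - y j))
    ((weight lam p (x k) e j - weight lam p (x s) (ε s) j) * (SignType.sign (x k j) : ℝ))
  have h7 := abs_sub (gradient f (x k) j - gradient f y j) (2 * Lk (s + 1) * (x k j - y j))
  linarith

lemma extendZero_eq {I : Finset (Fin n)} {y : EuclideanSpace ℝ (Fin n)}
    (h : ∀ j, j ∉ I → y j = 0) : (extendZero I fun i => y i) = y := by
  ext j
  simp only [extendZero]
  split_ifs with hj
  · rfl
  · exact (h j hj).symm

/-- Near a limit point, the gradient of the reduced objective at the iterates is bounded by the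
length of the last `2 T` steps. The smoothing parameters may be replaced by any smaller ones than
those of the previous iteration. -/
lemma exists_norm_reducedGradient_le {xs : EuclideanSpace ℝ (Fin n)} {ρ LG : ℝ} (hδ : δ < 1)
    (hμ : μ ∈ Set.Ioo (0 : ℝ) 1) (hprob : ProblemAssumption blk f lam p ℓ L)
    (hgen : IsGenerated blk f lam p ℓ L δ μ b Lk β x ε) (hcyc : EssentiallyCyclic b T)
    (hdesc : ∀ k, objective f lam p (x (k + 1)) (ε (k + 1)) ≤ objective f lam p (x k) (ε k))
    (hρ : 0 < ρ) (hLG : ∀ i : Fin m, ∀ y ∈ Metric.ball xs (4 * ρ), ∀ z ∈ Metric.ball xs (4 * ρ),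
      ‖blockPart blk i (gradient f y - gradient f z)‖ ≤ LG * ‖y - z‖) :
    ∃ C : ℝ, 0 < C ∧ ∀ᶠ k in atTop, dist (x k) xs < ρ → ∀ e : Fin n → ℝ,
      (∀ j, |e j| ≤ ε (k - 1) j) →
      ‖reducedGradient f lam p (limitSupport x) (reducedPair (limitSupport x) (x k) e)‖ ≤
        C * windowLen x √μ (2 * T) k := by
  obtain ⟨hν0, hν1⟩ := sqrt_mu_mem hμ
  obtain ⟨η, hη, hlow⟩ := exists_le_abs hδ hprob hμ hgen hcyc hdesc
  obtain ⟨Cε, hCε, heps⟩ := exists_eps_le_pow hμ hgen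
  obtain ⟨K₀, hK₀⟩ := eventually_atTop.1 hlow
  have hzero := eventually_apply_eq_zero hprob hμ hgen hdesc
  have hT := hcyc.pos
  have hWlim := tendsto_windowLen hν0.le hν1 (tendsto_dist_succ hδ hprob hμ hgen hcyc hdesc) (2 * T)
  have hlp : 0 < lam * p := mul_pos hprob.lam_pos hprob.p_pos
  have hp1 := hprob.p_lt_one
  set C₁ := 2 * |LG| + 4 * |L| + lam * p * ((1 - p) * η ^ (p - 2) * (1 + Cε ^ 2)) with hC₁
  set C₂ := lam * p * η ^ (p - 1) * (2 * Cε) with hC₂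
  have hC₁0 : 0 ≤ C₁ := by
    have : 0 ≤ 1 - p := by linarith
    positivity
  have hC₂0 : 0 < C₂ := by positivity
  refine ⟨(limitSupport x).card * (C₁ + C₂) + 1, by positivity, ?_⟩
  filter_upwards [hzero, hWlim.eventually_lt_const (by linarith : 0 < ρ / 2),
    eventually_ge_atTop (K₀ + 2 * T)] with k hz hWρ hk hxk e he
  set W := windowLen x √μ (2 * T) k with hW
  have hW0 : 0 ≤ W := windowLen_nonneg hν0.le
  have hprev : ∀ j ∈ limitSupport x, |e j| ≤ Cε * W := fun j hj =>
    (he j).trans ((heps j hj (k - 1)).trans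
      (by gcongr; exact pow_le_windowLen hν0.le (by omega) (by omega)))
  have hinl : ∀ i : limitSupport x, |reducedGradient f lam p (limitSupport x)
      (reducedPair (limitSupport x) (x k) e) (Sum.inl i)| ≤ C₁ * W := by
    rintro ⟨j, hj⟩
    have h1 := lt_lastUpdate_add hcyc (blk j) (by omega : T ≤ k)
    have h2 : lastUpdate b (blk j) k ≤ k := lastUpdate_le
    have hb := lastUpdate_spec (b := b) (i := blk j) (k := k) (by omega)
    have hxj := apply_lastUpdate hgen k j
    obtain ⟨s, hs⟩ : ∃ s, lastUpdate b (blk j) k = s + 1 :=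
      ⟨_, (Nat.sub_add_cancel (by omega)).symm⟩
    rw [hs] at h1 h2 hb hxj
    have hext : ‖extrapolated blk b β x (s + 1) - x s‖ ≤ W := by
      have h3 := lt_lastUpdate_add hcyc (b (s + 1)) (by omega : T ≤ s)
      have h4 : lastUpdate b (b (s + 1)) s ≤ s := lastUpdate_le
      refine (norm_extrapolated_sub_le hgen s).trans ?_
      refine (mul_le_of_le_one_left (norm_nonneg _) (hgen.beta_mem (s + 1) (by omega)).2).trans ?_
      obtain ⟨t, ht⟩ : ∃ t, lastUpdate b (b (s + 1)) s = t + 1 :=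
        ⟨_, (Nat.sub_add_cancel (by omega)).symm⟩
      rw [ht] at h3 h4 ⊢
      rw [Nat.add_sub_cancel, ← dist_eq_norm, dist_comm]
      exact dist_succ_le_windowLen hν0.le (by omega) (by omega)
    have h5 := abs_gradient_add_weight_le (Cε := Cε ^ 2) (W := W) (e := e) hprob hgen hLG hη
      hb.symm hxj (hK₀ k (by omega) j hj) (hK₀ s (by omega) j hj) hW0
      (by
        rw [← dist_eq_norm, dist_comm]
        exact dist_le_windowLen hν0.le (by omega) (by omega))
      hext (by linarith) hxk
      ((he j).trans (eps_antitone hμ hgen j (by omega : s ≤ k - 1)))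
      (by
        calc ε s j ^ 2 ≤ (Cε * √μ ^ s) ^ 2 :=
              pow_le_pow_left₀ (eps_pos hgen s j).le (heps j hj s) 2
          _ = Cε ^ 2 * (√μ ^ s * √μ ^ s) := by ring
          _ ≤ Cε ^ 2 * (1 * W) := by
              gcongr
              · exact pow_le_one₀ hν0.le hν1.le
              · exact pow_le_windowLen hν0.le (by omega) (by omega)
          _ = _ := by ring)
    have h6 : (extendZero (limitSupport x) fun i => x k i) = x k := extendZero_eq hz
    rw [weight] at h5
    simpa only [reducedGradient, reducedPair, Sum.elim_inl, Sum.elim_inr, h6] using h5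
  have hinr : ∀ i : limitSupport x, |reducedGradient f lam p (limitSupport x)
      (reducedPair (limitSupport x) (x k) e) (Sum.inr i)| ≤ C₂ * W := by
    rintro ⟨j, hj⟩
    have h1 := hK₀ k (by omega) j hj
    have h2 : (|x k j| + e j ^ 2) ^ (p - 1) ≤ η ^ (p - 1) :=
      Real.rpow_le_rpow_of_nonpos hη (by nlinarith [sq_nonneg (e j)]) (by linarith)
    have h3 := hprev j hj
    simp only [reducedGradient, reducedPair, Sum.elim_inl, Sum.elim_inr]
    rw [abs_mul, abs_mul, abs_mul 2, abs_of_pos hlp, abs_of_pos (two_pos : (0 : ℝ) < 2),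
      abs_of_nonneg (by positivity)]
    calc _ ≤ lam * p * η ^ (p - 1) * (2 * (Cε * W)) := by gcongr
      _ = _ := by rw [hC₂]; ring
  calc _ ≤ _ := norm_le_sum_abs _
    _ ≤ ∑ _i : limitSupport x, C₁ * W + ∑ _i : limitSupport x, C₂ * W := by
        rw [Fintype.sum_sum_type]
        exact add_le_add (Finset.sum_le_sum fun i _ => hinl i) (Finset.sum_le_sum fun i _ => hinr i)
    _ = (limitSupport x).card * (C₁ + C₂) * W := by simp; ring
    _ ≤ _ := by gcongr; linarith

end Generated

/-! ### The Łojasiewicz inequality along the iterates -/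

section Generated

variable {n m : ℕ} {blk : Fin n → Fin m} {f : EuclideanSpace ℝ (Fin n) → ℝ}
  {lam p ℓ L δ μ : ℝ} {T : ℕ} {b : ℕ → Fin m} {Lk β : ℕ → ℝ}
  {x : ℕ → EuclideanSpace ℝ (Fin n)} {ε : ℕ → Fin n → ℝ}

/-- On the late iterates the objective and the reduced objective differ by a constant, the
contribution of the frozen smoothing parameters outside the limit support. -/
lemma exists_objective_eq (hprob : ProblemAssumption blk f lam p ℓ L)
    (hμ : μ ∈ Set.Ioo (0 : ℝ) 1) (hgen : IsGenerated blk f lam p ℓ L δ μ b Lk β x ε)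
    (hdesc : ∀ k, objective f lam p (x (k + 1)) (ε (k + 1)) ≤ objective f lam p (x k) (ε k)) :
    ∃ c₀ : ℝ, ∀ᶠ k in atTop, objective f lam p (x k) (ε k) =
      reducedObjective f lam p (limitSupport x) (reducedPair (limitSupport x) (x k) (ε k)) +
        c₀ := by
  obtain ⟨K, hK⟩ := eventually_atTop.1 (eventually_apply_eq_zero hprob hμ hgen hdesc)
  refine ⟨lam * ∑ j ∈ (limitSupport x)ᶜ, (|(0 : ℝ)| + ε K j ^ 2) ^ p,
    eventually_atTop.2 ⟨K, fun k hk => ?_⟩⟩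
  have heps : ∀ j, j ∉ limitSupport x → ε k j = ε K j := by
    intro j hj
    induction k, hk using Nat.le_induction with
    | base => rfl
    | succ k hk ih => rw [hgen.eps_zero k j (hK (k + 1) (by omega) j hj), ih]
  have h1 : (extendZero (limitSupport x) fun i => x k i) = x k := extendZero_eq (hK k hk)
  have h2 : ∑ j ∈ (limitSupport x)ᶜ, (|x k j| + ε k j ^ 2) ^ p =
      ∑ j ∈ (limitSupport x)ᶜ, (|(0 : ℝ)| + ε K j ^ 2) ^ p := by
    refine Finset.sum_congr rfl fun j hj => ?_
    rw [hK k hk j (by simpa using hj), heps j (by simpa using hj)]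
  have h3 : ∑ i : limitSupport x, (|x k i| + ε k i ^ 2) ^ p =
      ∑ j ∈ limitSupport x, (|x k j| + ε k j ^ 2) ^ p :=
    Finset.sum_coe_sort (limitSupport x) fun j => (|x k j| + ε k j ^ 2) ^ p
  simp only [reducedObjective, reducedPair, Sum.elim_inl, Sum.elim_inr, objective]
  rw [h1, h3, ← h2, ← Finset.sum_add_sum_compl (limitSupport x)]
  ring

lemma tendsto_objective (hδ : δ < 1) (hprob : ProblemAssumption blk f lam p ℓ L)
    (hμ : μ ∈ Set.Ioo (0 : ℝ) 1) (hgen : IsGenerated blk f lam p ℓ L δ μ b Lk β x ε)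
    (hcyc : EssentiallyCyclic b T)
    (hdesc : ∀ k, objective f lam p (x (k + 1)) (ε (k + 1)) ≤ objective f lam p (x k) (ε k))
    {F : ℝ} (hF : Tendsto (lyapunov f lam p b Lk x ε) atTop (𝓝 F)) :
    Tendsto (fun k => objective f lam p (x k) (ε k)) atTop (𝓝 F) := by
  obtain ⟨hν0, hν1⟩ := sqrt_mu_mem hμ
  have hW := tendsto_windowLen hν0.le hν1 (tendsto_dist_succ hδ hprob hμ hgen hcyc hdesc) T
  have h1 : Tendsto (fun k => m * L * windowLen x √μ T k ^ 2) atTop (𝓝 0) := by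
    simpa using (hW.pow 2).const_mul (m * L)
  have h2 : Tendsto (fun k => ∑ i, Lk (lastUpdate b i k) *
      ‖x (lastUpdate b i k) - x (lastUpdate b i k - 1)‖ ^ 2) atTop (𝓝 0) :=
    squeeze_zero' (.of_forall fun k => Finset.sum_nonneg fun i _ =>
      step_energy_nonneg hprob.ell_pos hgen _)
      ((eventually_ge_atTop T).mono fun k hk => step_energy_sum_le hprob hgen hcyc hν0.le le_rfl hk)
      h1
  have h3 := hF.sub (h2.const_mul (1 / 4))
  rw [mul_zero, sub_zero] at h3
  exact h3.congr fun k => add_sub_cancel_right _ _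

lemma norm_reducedPair_sub_le {I : Finset (Fin n)} (y z : EuclideanSpace ℝ (Fin n))
    (e : Fin n → ℝ) :
    ‖reducedPair I y e - reducedPoint I z‖ ≤ I.card * ‖y - z‖ + ∑ j ∈ I, |e j| := by
  refine (norm_le_sum_abs _).trans ?_
  rw [Fintype.sum_sum_type, ← Finset.sum_coe_sort I]
  refine add_le_add ?_ ?_
  · calc _ ≤ ∑ _i : I, ‖y - z‖ := Finset.sum_le_sum fun i _ => abs_apply_le_norm (y - z) i
      _ = _ := by simp
  · simp [reducedPair, reducedPoint]

/-- The limit of the objective is the value of the reduced objective at the limit point. -/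
lemma objective_limit_eq {xs : EuclideanSpace ℝ (Fin n)} (hprob : ProblemAssumption blk f lam p ℓ L)
    (hμ : μ ∈ Set.Ioo (0 : ℝ) 1) (hgen : IsGenerated blk f lam p ℓ L δ μ b Lk β x ε)
    (hxs : MapClusterPt xs atTop x) {F c₀ : ℝ}
    (hF : Tendsto (fun k => objective f lam p (x k) (ε k)) atTop (𝓝 F))
    (hc₀ : ∀ᶠ k in atTop, objective f lam p (x k) (ε k) =
      reducedObjective f lam p (limitSupport x) (reducedPair (limitSupport x) (x k) (ε k)) + c₀) :
    F = reducedObjective f lam p (limitSupport x) (reducedPoint (limitSupport x) xs) + c₀ := by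
  obtain ⟨ψ, hψ, hx⟩ := MapClusterPt.tendsto_subseq hxs
  have h1 : Tendsto (fun k => ∑ j ∈ limitSupport x, |ε (ψ k) j|) atTop (𝓝 0) := by
    rw [← Finset.sum_const_zero (s := limitSupport x)]
    refine tendsto_finsetSum _ fun j hj => ?_
    have := (tendsto_eps_zero hμ hgen (mem_limitSupport.1 hj).frequently).comp hψ.tendsto_atTop
    simpa using this.abs
  have h2 : Tendsto (fun k => reducedPair (limitSupport x) (x (ψ k)) (ε (ψ k))) atTop
      (𝓝 (reducedPoint (limitSupport x) xs)) := by
    rw [tendsto_iff_norm_sub_tendsto_zero] at hx ⊢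
    refine squeeze_zero (fun _ => norm_nonneg _) (fun k => norm_reducedPair_sub_le _ _ _) ?_
    simpa using (hx.const_mul ((limitSupport x).card : ℝ)).add h1
  have h3 := ((continuous_reducedObjective (lam := lam) hprob.contDiff.continuous
    hprob.p_pos).tendsto _).comp h2
  refine tendsto_nhds_unique (hF.comp hψ.tendsto_atTop) ((h3.add_const c₀).congr' ?_)
  filter_upwards [hψ.tendsto_atTop.eventually hc₀] with k hk using hk.symm

/-- The Łojasiewicz inequality along the iterates that are close to the limit point. -/
lemma exists_reducedObjective_rpow_le {xs : EuclideanSpace ℝ (Fin n)} {ρ LG c θ : ℝ} (hδ : δ < 1)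
    (hμ : μ ∈ Set.Ioo (0 : ℝ) 1) (hprob : ProblemAssumption blk f lam p ℓ L)
    (hgen : IsGenerated blk f lam p ℓ L δ μ b Lk β x ε) (hcyc : EssentiallyCyclic b T)
    (hdesc : ∀ k, objective f lam p (x (k + 1)) (ε (k + 1)) ≤ objective f lam p (x k) (ε k))
    (hρ : 0 < ρ) (hLG : ∀ i : Fin m, ∀ y ∈ Metric.ball xs (4 * ρ), ∀ z ∈ Metric.ball xs (4 * ρ),
      ‖blockPart blk i (gradient f y - gradient f z)‖ ≤ LG * ‖y - z‖)
    (hc : 0 < c) (hθ : θ < 1)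
    (hKL : HasKLProperty (reducedObjective f lam p (limitSupport x))
      (reducedPoint (limitSupport x) xs) (fun s : ℝ => c * s ^ (1 - θ))) :
    ∃ C r : ℝ, 0 < C ∧ 0 < r ∧ ∀ᶠ k in atTop, dist (x k) xs < r → ∀ e : Fin n → ℝ,
      (∀ j, |e j| ≤ ε (k - 1) j) →
      reducedObjective f lam p (limitSupport x) (reducedPoint (limitSupport x) xs) <
        reducedObjective f lam p (limitSupport x) (reducedPair (limitSupport x) (x k) e) →
      (reducedObjective f lam p (limitSupport x) (reducedPair (limitSupport x) (x k) e) -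
        reducedObjective f lam p (limitSupport x) (reducedPoint (limitSupport x) xs)) ^ θ ≤
        C * windowLen x √μ (2 * T) k := by
  obtain ⟨C, hC, hgrad⟩ := exists_norm_reducedGradient_le hδ hμ hprob hgen hcyc hdesc hρ hLG
  obtain ⟨r, hr, hloj⟩ := hKL.exists_rpow_le
    (continuous_reducedObjective hprob.contDiff.continuous hprob.p_pos).continuousAt
  have h1θ : 0 < 1 - θ := by linarith
  set a : ℝ := (limitSupport x).card + 1 with ha
  have ha0 : 0 < a := by positivity
  have hε : Tendsto (fun k => ∑ j ∈ limitSupport x, ε (k - 1) j) atTop (𝓝 0) := by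
    rw [← Finset.sum_const_zero (s := limitSupport x)]
    exact tendsto_finsetSum _ fun j hj =>
      (tendsto_eps_zero hμ hgen (mem_limitSupport.1 hj).frequently).comp (tendsto_sub_atTop_nat 1)
  have hne : ∀ᶠ k in atTop, ∀ j ∈ limitSupport x, x k j ≠ 0 :=
    (eventually_all_finset _).2 fun j hj => mem_limitSupport.1 hj
  refine ⟨c * (1 - θ) * C, min ρ (r / (2 * a)), by positivity, lt_min hρ (by positivity), ?_⟩
  filter_upwards [hgrad, hε.eventually_lt_const (by linarith : 0 < r / 2), hne]
    with k h1 h2 h3 hx e he hlt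
  have h4 := h1 (hx.trans_le (min_le_left _ _)) e he
  have hball : reducedPair (limitSupport x) (x k) e ∈
      Metric.ball (reducedPoint (limitSupport x) xs) r := by
    rw [mem_ball_iff_norm]
    have h5 := norm_reducedPair_sub_le (I := limitSupport x) (x k) xs e
    have h6 : ∑ j ∈ limitSupport x, |e j| ≤ ∑ j ∈ limitSupport x, ε (k - 1) j :=
      Finset.sum_le_sum fun j _ => he j
    have h7 : ‖x k - xs‖ < r / (2 * a) := by
      rw [← dist_eq_norm]; exact hx.trans_le (min_le_right _ _)
    have h8 : (limitSupport x).card * ‖x k - xs‖ ≤ a * (r / (2 * a)) := by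
      gcongr
      linarith
    have h9 : a * (r / (2 * a)) = r / 2 := by field_simp
    linarith
  have h5 := hloj _ hball hlt _ (reducedGradient_mem
    (hprob.contDiff.differentiable one_ne_zero) fun i => h3 i i.2)
  calc _ ≤ _ := h5
    _ ≤ c * (1 - θ) * (C * windowLen x √μ (2 * T) k) := by gcongr
    _ = _ := by ring

/-- The Lyapunov function relative to its limit, enlarged by a geometric term so that its decrease
also controls the smoothing parameters. -/
noncomputable def gap (f : EuclideanSpace ℝ (Fin n) → ℝ) (lam p μ : ℝ) (b : ℕ → Fin m)
    (Lk : ℕ → ℝ) (x : ℕ → EuclideanSpace ℝ (Fin n)) (ε : ℕ → Fin n → ℝ) (F : ℝ) (k : ℕ) : ℝ :=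
  lyapunov f lam p b Lk x ε k - F + (√μ ^ k) ^ 2

lemma exists_gap_decrease (hδ : δ < 1) (hprob : ProblemAssumption blk f lam p ℓ L)
    (hμ : μ ∈ Set.Ioo (0 : ℝ) 1) (hgen : IsGenerated blk f lam p ℓ L δ μ b Lk β x ε)
    (hcyc : EssentiallyCyclic b T) (F : ℝ) :
    ∃ γ : ℝ, 0 < γ ∧ ∀ k, γ * stepLen x √μ k ^ 2 ≤
      gap f lam p μ b Lk x ε F k - gap f lam p μ b Lk x ε F (k + 1) := by
  obtain ⟨hν0, hν1⟩ := sqrt_mu_mem hμ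
  have hc : 0 < (1 - δ) / 4 * ℓ := mul_pos (by linarith) hprob.ell_pos
  have hν2 : 0 < 1 - √μ ^ 2 := by nlinarith
  set γ := min ((1 - δ) / 4 * ℓ) (1 - √μ ^ 2)
  have hγ : 0 < γ := lt_min hc hν2
  refine ⟨γ / 2, by linarith, fun k => ?_⟩
  have h1 := lyapunov_decrease hδ hprob hμ hgen hcyc k
  rw [← dist_eq_norm, dist_comm] at h1
  simp only [gap, stepLen]
  set d := dist (x k) (x (k + 1))
  have h2 : (√μ ^ (k + 1)) ^ 2 = √μ ^ 2 * (√μ ^ k) ^ 2 := by ring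
  rw [h2]
  set v := √μ ^ k
  have h3 : γ * d ^ 2 ≤ (1 - δ) / 4 * ℓ * d ^ 2 := by gcongr; exact min_le_left _ _
  have h4 : γ * v ^ 2 ≤ (1 - √μ ^ 2) * v ^ 2 := by gcongr; exact min_le_right _ _
  have h5 : γ / 2 * (d + v) ^ 2 ≤ γ * d ^ 2 + γ * v ^ 2 := by nlinarith [sq_nonneg (d - v)]
  linarith

/-- The Łojasiewicz inequality for `gap`. An exponent below `1 / 2` is weakened to `1 / 2`, which
is what the squares of the steps in the Lyapunov function allow. -/
lemma exists_gap_rpow_le {xs : EuclideanSpace ℝ (Fin n)} {ρ LG c θ : ℝ} (hδ : δ < 1)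
    (hμ : μ ∈ Set.Ioo (0 : ℝ) 1) (hprob : ProblemAssumption blk f lam p ℓ L)
    (hgen : IsGenerated blk f lam p ℓ L δ μ b Lk β x ε) (hcyc : EssentiallyCyclic b T)
    (hdesc : ∀ k, objective f lam p (x (k + 1)) (ε (k + 1)) ≤ objective f lam p (x k) (ε k))
    (hxs : MapClusterPt xs atTop x)
    (hρ : 0 < ρ) (hLG : ∀ i : Fin m, ∀ y ∈ Metric.ball xs (4 * ρ), ∀ z ∈ Metric.ball xs (4 * ρ),
      ‖blockPart blk i (gradient f y - gradient f z)‖ ≤ LG * ‖y - z‖)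
    (hc : 0 < c) (hθ0 : 0 < θ) (hθ : θ < 1)
    (hKL : HasKLProperty (reducedObjective f lam p (limitSupport x))
      (reducedPoint (limitSupport x) xs) (fun s : ℝ => c * s ^ (1 - θ)))
    {F : ℝ} (hF : Tendsto (lyapunov f lam p b Lk x ε) atTop (𝓝 F)) :
    ∃ C r : ℝ, 0 < C ∧ 0 < r ∧ ∀ᶠ k in atTop, dist (x k) xs < r →
      gap f lam p μ b Lk x ε F k ^ max θ (1 / 2) ≤ C * windowLen x √μ (2 * T) k := by
  obtain ⟨hν0, hν1⟩ := sqrt_mu_mem hμ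
  obtain ⟨C, r, hC, hr, hloj⟩ := exists_reducedObjective_rpow_le hδ hμ hprob hgen hcyc hdesc hρ hLG
    hc hθ hKL
  have hobj := tendsto_objective hδ hprob hμ hgen hcyc hdesc hF
  obtain ⟨c₀, hc₀⟩ := exists_objective_eq hprob hμ hgen hdesc
  have hFeq := objective_limit_eq hprob hμ hgen hxs hobj hc₀
  have hFle : ∀ k, F ≤ objective f lam p (x k) (ε k) :=
    (antitone_nat_of_succ_le hdesc).le_of_tendsto hobj
  have hT := hcyc.pos
  set θ' := max θ (1 / 2) with hθ'
  have hθ'1 : θ' < 1 := max_lt hθ (by norm_num)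
  have hθ'0 : 1 / 2 ≤ θ' := le_max_right _ _
  have hW := tendsto_windowLen hν0.le hν1 (tendsto_dist_succ hδ hprob hμ hgen hcyc hdesc) (2 * T)
  set D := 1 / 4 * (m * |L|) + 1 with hD
  have hD0 : 0 < D := by positivity
  have hDW : Tendsto (fun k => D * windowLen x √μ (2 * T) k ^ 2) atTop (𝓝 0) := by
    simpa using (hW.pow 2).const_mul D
  refine ⟨C + √D, r, by positivity, hr, ?_⟩
  filter_upwards [hloj, hc₀, hobj.eventually_le_const (by linarith : F < F + 1),
    hDW.eventually_le_const one_pos, eventually_ge_atTop (2 * T)] with k h1 h2 h3 h4 h5 hx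
  set W := windowLen x √μ (2 * T) k
  have hW0 : 0 ≤ W := windowLen_nonneg hν0.le
  set a := objective f lam p (x k) (ε k) - F with ha
  set S := ∑ i, Lk (lastUpdate b i k) *
    ‖x (lastUpdate b i k) - x (lastUpdate b i k - 1)‖ ^ 2 with hS
  have hS0 : 0 ≤ S := Finset.sum_nonneg fun i _ => step_energy_nonneg hprob.ell_pos hgen _
  have hSW : S ≤ m * L * W ^ 2 :=
    step_energy_sum_le hprob hgen hcyc hν0.le (by omega) (by omega)
  have hvW : √μ ^ k ≤ W := by
    refine le_trans ?_ (pow_le_windowLen hν0.le (by omega : k ≤ k - 1 + 2 * T) (by omega))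
    exact pow_le_pow_of_le_one hν0.le hν1.le (by omega)
  set q := 1 / 4 * S + (√μ ^ k) ^ 2 with hq
  have hq0 : 0 ≤ q := by positivity
  have hqW : q ≤ D * W ^ 2 := by
    have h6 : m * L * W ^ 2 ≤ m * |L| * W ^ 2 := by gcongr; exact le_abs_self L
    have h7 : (√μ ^ k) ^ 2 ≤ W ^ 2 := pow_le_pow_left₀ (by positivity) hvW 2
    rw [hD, hq]
    linarith
  have ha0 : 0 ≤ a := sub_nonneg.2 (hFle k)
  have ha1 : a ≤ 1 := by linarith
  have hgap : gap f lam p μ b Lk x ε F k = a + q := by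
    simp only [gap, lyapunov]
    rw [ha, hq, hS]
    ring
  have hleft : a ^ θ' ≤ C * W := by
    rcases ha0.eq_or_lt with h | h
    · rw [← h, Real.zero_rpow (by linarith)]
      positivity
    · have h6 : a = reducedObjective f lam p (limitSupport x)
          (reducedPair (limitSupport x) (x k) (ε k)) -
          reducedObjective f lam p (limitSupport x) (reducedPoint (limitSupport x) xs) := by
        rw [ha, h2]; linarith
      have h7 := h1 hx (ε k) (fun j => by
        rw [abs_of_pos (eps_pos hgen k j)]
        exact eps_antitone hμ hgen j (Nat.sub_le k 1)) (by linarith)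
      rw [← h6] at h7
      exact (Real.rpow_le_rpow_of_exponent_ge h ha1 (le_max_left _ _)).trans h7
  have hright : q ^ θ' ≤ √D * W := by
    rcases hq0.eq_or_lt with h | h
    · rw [← h, Real.zero_rpow (by linarith)]
      positivity
    · calc q ^ θ' ≤ q ^ (1 / 2 : ℝ) :=
            Real.rpow_le_rpow_of_exponent_ge h (hqW.trans h4) hθ'0
        _ = √q := (Real.sqrt_eq_rpow q).symm
        _ ≤ √(D * W ^ 2) := Real.sqrt_le_sqrt hqW
        _ = √D * W := by rw [Real.sqrt_mul hD0.le, Real.sqrt_sq hW0]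
  rw [hgap]
  calc (a + q) ^ θ' ≤ a ^ θ' + q ^ θ' := Real.rpow_add_le_add_rpow ha0 hq0 (by linarith) hθ'1.le
    _ ≤ C * W + √D * W := add_le_add hleft hright
    _ = _ := by ring

/-- For `θ = 0` the Łojasiewicz inequality bounds the gradient away from `0` wherever the value
exceeds the limit value, although at `(x^k, ε^{k-1})` the value does exceed it and the gradient
tends to `0`. Hence the limit support is empty. -/
lemma limitSupport_eq_empty {xs : EuclideanSpace ℝ (Fin n)} {ρ LG c : ℝ} (hδ : δ < 1)
    (hμ : μ ∈ Set.Ioo (0 : ℝ) 1) (hprob : ProblemAssumption blk f lam p ℓ L)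
    (hgen : IsGenerated blk f lam p ℓ L δ μ b Lk β x ε) (hcyc : EssentiallyCyclic b T)
    (hdesc : ∀ k, objective f lam p (x (k + 1)) (ε (k + 1)) ≤ objective f lam p (x k) (ε k))
    (hxs : MapClusterPt xs atTop x)
    (hρ : 0 < ρ) (hLG : ∀ i : Fin m, ∀ y ∈ Metric.ball xs (4 * ρ), ∀ z ∈ Metric.ball xs (4 * ρ),
      ‖blockPart blk i (gradient f y - gradient f z)‖ ≤ LG * ‖y - z‖)
    (hc : 0 < c)
    (hKL : HasKLProperty (reducedObjective f lam p (limitSupport x))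
      (reducedPoint (limitSupport x) xs) (fun s : ℝ => c * s ^ (1 - 0 : ℝ))) :
    limitSupport x = ∅ := by
  obtain ⟨hν0, hν1⟩ := sqrt_mu_mem hμ
  by_contra hne
  obtain ⟨j, hj⟩ := Finset.nonempty_iff_ne_empty.2 hne
  obtain ⟨C, r, hC, hr, hloj⟩ := exists_reducedObjective_rpow_le hδ hμ hprob hgen hcyc hdesc hρ hLG
    hc one_pos hKL
  obtain ⟨F, hF, -⟩ := exists_tendsto_lyapunov hδ hprob hμ hgen hcyc hdesc
  have hobj := tendsto_objective hδ hprob hμ hgen hcyc hdesc hF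
  obtain ⟨c₀, hc₀⟩ := exists_objective_eq hprob hμ hgen hdesc
  have hFeq := objective_limit_eq hprob hμ hgen hxs hobj hc₀
  have hFle : ∀ k, F ≤ objective f lam p (x k) (ε k) :=
    (antitone_nat_of_succ_le hdesc).le_of_tendsto hobj
  have hW := tendsto_windowLen hν0.le hν1 (tendsto_dist_succ hδ hprob hμ hgen hcyc hdesc) (2 * T)
  have hCW : Tendsto (fun k => C * windowLen x √μ (2 * T) k) atTop (𝓝 0) := by
    simpa using hW.const_mul C
  obtain ⟨k, hk1, ((hk2 : _ → _) : _), hk3, hk4, hk5, hk6⟩ :=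
    ((hxs.frequently (Metric.ball_mem_nhds xs hr)).and_eventually (hloj.and (hc₀.and
      ((hCW.eventually_lt_const one_pos).and ((mem_limitSupport.1 hj).and
        (eventually_ge_atTop 1)))))).exists
  obtain ⟨s, rfl⟩ : ∃ s, k = s + 1 := ⟨k - 1, by omega⟩
  have hlt : reducedObjective f lam p (limitSupport x)
      (reducedPair (limitSupport x) (x (s + 1)) (ε (s + 1))) < reducedObjective f lam p
      (limitSupport x) (reducedPair (limitSupport x) (x (s + 1)) (ε s)) := by
    simp only [reducedObjective, reducedPair, Sum.elim_inl, Sum.elim_inr]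
    refine add_lt_add_of_le_of_lt le_rfl (mul_lt_mul_of_pos_left ?_ hprob.lam_pos)
    have hp := hprob.p_pos
    refine Finset.sum_lt_sum (fun i _ => ?_) ⟨⟨j, hj⟩, Finset.mem_univ _, ?_⟩
    · have h1 := eps_pos hgen (s + 1) i
      have h2 := eps_succ_le hμ hgen s i
      gcongr
    · have h1 := eps_pos hgen (s + 1) j
      have h2 : ε (s + 1) j < ε s j := (hgen.eps_nonzero s j hk5).2.trans_lt
        (mul_lt_of_lt_one_left (eps_pos hgen s j) hν1)
      dsimp only
      gcongr
  have h1 := hk2 hk1 (ε s) (fun i => (abs_of_pos (eps_pos hgen s i)).le)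
    (by linarith [hFle (s + 1)])
  rw [Real.rpow_zero] at h1
  linarith

lemma isBigO_epsNorm (hμ : μ ∈ Set.Ioo (0 : ℝ) 1)
    (hgen : IsGenerated blk f lam p ℓ L δ μ b Lk β x ε) (hcyc : EssentiallyCyclic b T) :
    (fun k => epsNorm blk b ε (limitSupport x) (3 * (k - 1) * T)) =O[atTop] fun k => √μ ^ k := by
  obtain ⟨hν0, hν1⟩ := sqrt_mu_mem hμ
  obtain ⟨C, hC, heps⟩ := exists_eps_le_pow hμ hgen
  have hT := hcyc.pos
  refine Asymptotics.IsBigO.of_bound ((limitSupport x).card * (C * (√μ ^ (T + 1))⁻¹))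
    (.of_forall fun k => ?_)
  rw [epsNorm, Real.norm_of_nonneg (Finset.sum_nonneg fun j _ => abs_nonneg _),
    Real.norm_of_nonneg (by positivity)]
  calc _ ≤ ∑ _j ∈ limitSupport x, C * (√μ ^ (T + 1))⁻¹ * √μ ^ k := by
        refine Finset.sum_le_sum fun j hj => ?_
        rw [abs_of_pos (eps_pos hgen _ j), mul_assoc C]
        refine (heps j hj _).trans (mul_le_mul_of_nonneg_left ?_ hC.le)
        rw [le_inv_mul_iff₀ (by positivity), ← pow_add]
        refine pow_le_pow_of_le_one hν0.le hν1.le ?_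
        have h1 := le_lastUpdate_add hcyc (blk j) (3 * (k - 1) * T)
        have h2 : 3 * (k - 1) ≤ 3 * (k - 1) * T := Nat.le_mul_of_pos_right _ hT
        omega
    _ = _ := by simp; ring

/-- Rates with the smoothing term: a rate that dominates both the distance to the limit and a
geometric sequence leaves room for `epsNorm`. -/
lemma exists_rate_of_isBigO {xs : EuclideanSpace ℝ (Fin n)} (hμ : μ ∈ Set.Ioo (0 : ℝ) 1)
    (hgen : IsGenerated blk f lam p ℓ L δ μ b Lk β x ε) (hcyc : EssentiallyCyclic b T) {g : ℕ → ℝ}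
    (hg0 : ∀ k, 0 ≤ g k) (hx : (fun k => dist (x k) xs) =O[atTop] g)
    (hν : (fun k => √μ ^ k) =O[atTop] g) :
    ∃ c₁ c₂ : ℝ, 0 < c₁ ∧ 0 < c₂ ∧ ∀ k, g k ≠ 0 → ‖x k - xs‖ ≤
      c₁ * g k - c₂ * epsNorm blk b ε (limitSupport x) (3 * (k - 1) * T) := by
  obtain ⟨C, hC, h⟩ := Asymptotics.bound_of_isBigO_nat_atTop
    (hx.add ((isBigO_epsNorm hμ hgen hcyc).trans hν))
  refine ⟨C, 1, hC, one_pos, fun k hk => ?_⟩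
  have h1 := h hk
  rw [Real.norm_of_nonneg (hg0 k), dist_eq_norm] at h1
  have h2 := (Real.le_norm_self _).trans h1
  linarith

end Generated

end BPIRe

open BPIRe in
theorem mainTheorem8 {n m : ℕ} (blk : Fin n → Fin m) (f : EuclideanSpace ℝ (Fin n) → ℝ)
    (lam p ℓ L δ μ : ℝ) (T : ℕ) (b : ℕ → Fin m) (Lk β : ℕ → ℝ)
    (x : ℕ → EuclideanSpace ℝ (Fin n)) (ε : ℕ → Fin n → ℝ)
    (hδ : δ < 1) (hμ : μ ∈ Set.Ioo (0 : ℝ) 1)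
    (hprob : BPIRe.ProblemAssumption blk f lam p ℓ L)
    (hgen : BPIRe.IsGenerated blk f lam p ℓ L δ μ b Lk β x ε)
    (hcyc : BPIRe.EssentiallyCyclic b T)
    (hdesc : ∀ k, BPIRe.objective f lam p (x (k + 1)) (ε (k + 1)) ≤
      BPIRe.objective f lam p (x k) (ε k))
    (xstar : EuclideanSpace ℝ (Fin n)) (hxstar : MapClusterPt xstar atTop x)
    (ρ LG : ℝ) (hρ : 0 < ρ)
    (hLG : ∀ i : Fin m, ∀ y ∈ Metric.ball xstar (4 * ρ), ∀ z ∈ Metric.ball xstar (4 * ρ),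
      ‖BPIRe.blockPart blk i (gradient f y - gradient f z)‖ ≤ LG * ‖y - z‖)
    (c θ : ℝ) (hc : 0 < c) (hθ : θ ∈ Set.Ico (0 : ℝ) 1)
    (hKL : BPIRe.HasKLProperty (BPIRe.reducedObjective f lam p (BPIRe.limitSupport x))
      (BPIRe.reducedPoint (BPIRe.limitSupport x) xstar) (fun s : ℝ => c * s ^ (1 - θ))) :
    (θ = 0 → ∃ k₀ : ℕ, ∀ k, k₀ ≤ k → x k = xstar) ∧
    (0 < θ → θ ≤ 1 / 2 → ∃ c₁₀ c₁₁ α : ℝ, 0 < c₁₀ ∧ 0 < c₁₁ ∧ 0 ≤ α ∧ α < 1 ∧ ∀ k : ℕ,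
      ‖x k - xstar‖ ≤ c₁₀ * α ^ k -
        c₁₁ * BPIRe.epsNorm blk b ε (BPIRe.limitSupport x) (3 * (k - 1) * T)) ∧
    (1 / 2 < θ → ∃ c₁₂ c₁₃ : ℝ, 0 < c₁₂ ∧ 0 < c₁₃ ∧ ∀ k : ℕ, 1 ≤ k →
      ‖x k - xstar‖ ≤ c₁₂ * (k : ℝ) ^ (-(1 - θ) / (2 * θ - 1)) -
        c₁₃ * BPIRe.epsNorm blk b ε (BPIRe.limitSupport x) (3 * (k - 1) * T)) := by
  obtain ⟨hν0, hν1⟩ := sqrt_mu_mem hμ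
  have hT := hcyc.pos
  obtain ⟨F, hF, hFle⟩ := exists_tendsto_lyapunov hδ hprob hμ hgen hcyc hdesc
  obtain ⟨γ, hγ, hdec⟩ := exists_gap_decrease hδ hprob hμ hgen hcyc F
  have hgap0 : ∀ k, 0 ≤ gap f lam p μ b Lk x ε F k := fun k =>
    add_nonneg (sub_nonneg.2 (hFle k)) (sq_nonneg _)
  have hgaplim : Tendsto (gap f lam p μ b Lk x ε F) atTop (𝓝 0) := by
    have h := (hF.sub_const F).add ((tendsto_pow_atTop_nhds_zero_of_lt_one hν0.le hν1).pow 2)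
    rwa [sub_self, zero_pow two_ne_zero, add_zero] at h
  have hbatch : 0 < θ → ∃ (K : ℕ) (B D : ℝ), 0 < B ∧ 0 < D ∧
      (∀ q k, K + q * (2 * T) ≤ k → dist (x k) xstar ≤
        B * gap f lam p μ b Lk x ε F (K + q * (2 * T)) ^ (1 - max θ (1 / 2))) ∧
      ∀ q, gap f lam p μ b Lk x ε F (K + (q + 1) * (2 * T)) ^ (2 * max θ (1 / 2)) ≤
        D * (gap f lam p μ b Lk x ε F (K + q * (2 * T)) -
          gap f lam p μ b Lk x ε F (K + (q + 1) * (2 * T))) := by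
    intro hθ0
    obtain ⟨C, r, hC, hr, hloj⟩ := exists_gap_rpow_le hδ hμ hprob hgen hcyc hdesc hxstar hρ hLG hc
      hθ0 hθ.2 hKL hF
    exact exists_batch_bound (e := stepLen x √μ) (by omega) hγ hC (le_max_right _ _)
      (max_lt hθ.2 (by norm_num)) hr hgap0 (fun k => stepLen_nonneg hν0.le k) hdec hgaplim
      (fun k => le_add_of_nonneg_right (pow_nonneg hν0.le k)) hxstar hloj
  refine ⟨?_, ?_, ?_⟩
  · rintro rfl
    have hempty := limitSupport_eq_empty hδ hμ hprob hgen hcyc hdesc hxstar hρ hLG hc hKL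
    obtain ⟨K, hK⟩ := eventually_atTop.1 (eventually_apply_eq_zero hprob hμ hgen hdesc)
    have hx0 : ∀ k, K ≤ k → x k = 0 := fun k hk => by
      ext j
      exact hK k hk j (by simp [hempty])
    have hlim : Tendsto x atTop (𝓝 0) :=
      tendsto_const_nhds.congr' (eventually_atTop.2 ⟨K, fun k hk => (hx0 k hk).symm⟩)
    obtain ⟨ψ, hψ, hxψ⟩ := MapClusterPt.tendsto_subseq hxstar
    have hxs : xstar = 0 := tendsto_nhds_unique hxψ (hlim.comp hψ.tendsto_atTop)
    exact ⟨K, fun k hk => by rw [hx0 k hk, hxs]⟩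
  · intro hθ0 hθ1
    obtain ⟨K, B, D, hB, hD, h1, h2⟩ := hbatch hθ0
    rw [max_eq_right hθ1] at h1 h2
    norm_num at h1 h2
    obtain ⟨α, hα0, hα1, hO⟩ := isBigO_pow_of_batch_bound (by omega) hB hD
      (fun k => dist_nonneg) hgap0 (by norm_num; exact h1) h2
    have hα : 0 < max α √μ := lt_max_of_lt_left hα0
    obtain ⟨c₁, c₂, hc₁, hc₂, h⟩ := exists_rate_of_isBigO (xs := xstar) (g := fun k => max α √μ ^ k)
      hμ hgen hcyc (fun k => by positivity)
      (hO.trans (Asymptotics.IsBigO.of_bound' (.of_forall fun k => by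
        rw [Real.norm_of_nonneg (by positivity), Real.norm_of_nonneg (by positivity)]
        gcongr
        exact le_max_left _ _)))
      (Asymptotics.IsBigO.of_bound' (.of_forall fun k => by
        rw [Real.norm_of_nonneg (by positivity), Real.norm_of_nonneg (by positivity)]
        gcongr
        exact le_max_right _ _))
    exact ⟨c₁, c₂, max α √μ, hc₁, hc₂, hα.le, max_lt hα1 hν1, fun k => h k (by positivity)⟩
  · intro hθ1
    obtain ⟨K, B, D, hB, hD, h1, h2⟩ := hbatch (by linarith)
    rw [max_eq_left hθ1.le] at h1 h2
    have hO := isBigO_rpow_of_batch_bound (by omega) hB hD hθ1 hθ.2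
      (fun k => dist_nonneg) hgap0 h1 h2
    obtain ⟨c₁, c₂, hc₁, hc₂, h⟩ := exists_rate_of_isBigO hμ hgen hcyc (fun k => by positivity) hO
      (isBigO_pow_rpow hν0 hν1 _)
    refine ⟨c₁, c₂, hc₁, hc₂, fun k hk => h k ?_⟩
    have : (0 : ℝ) < k := by exact_mod_cast hk
    positivity
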